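/- An index is a finite tuple $\mathbf k=(k_1,\dots,k_r)$ of positive integers, with weight $k_1+\cdots+k_r$; it is admissible if it is empty or $k_1\ge 2$. Let $\mathfrak h=\mathbb Q\langle x_0,x_1\rangle$ with shuffle product $\sqcup\!\sqcup$ (given by $uw\,\mathbin{\sqcup\!\sqcup}\,vw'=u(w\,\mathbin{\sqcup\!\sqcup}\,vw')+v(uw\,\mathbin{\sqcup\!\sqcup}\,w')$ for letters $u,v$, and $1\,\mathbin{\sqcup\!\sqcup}\,w=w=w\,\mathbin{\sqcup\!\sqcup}\,1$), let $\mathfrak h^0=\mathbb Q+x_0\mathfrak hx_1\subset\mathfrak h^1=\mathbb Q+\mathfrak hx_1$, $y_k=x_0^{k-1}x_1$ and $y_{\mathbf k}=y_{k_1}\cdots y_{k_r}$; the $y_{\mathbf k}$ form a basis of $\mathfrak h^1$. Finite side. Let $\mathcal A=\big(\prod_p\mathbb F_p\big)/\big(\bigoplus_p\mathbb F_p\big)$, with $p$ running over the primes, a $\mathbb Q$-algebra. Put $$H_n(\mathbf k)=\sum_{n>m_1>\cdots>m_r>0}\frac1{m_1^{k_1}\cdots m_r^{k_r}},\qquad \omega_n(\mathbf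 k)=\sum_{\substack{m_1+\cdots+m_r=n\\ m_a>0}}\ \prod_{a=1}^r\frac1{m_a^{k_a}},$$ $\zeta_{\mathcal A}(\mathbf k)=(H_p(\mathbf k)\bmod p)_p\in\mathcal A$ and, for $r\ge2$, $\omega_{\mathcal A}(\mathbf k)=(\omega_p(\mathbf k)\bmod p)_p\in\mathcal A$. Let $\mathcal Z^{\mathcal A}$ be the $\mathbb Q$-algebra spanned over $\mathbb Q$ by all $\zeta_{\mathcal A}(\mathbf k)$. Symmetric side. Let $\mathcal Z\subset\mathbb R$ be the $\mathbb Q$-algebra spanned over $\mathbb Q$ by the multiple zeta values $\zeta(\mathbf k)=\sum_{m_1>\cdots>m_r>0}m_1^{-k_1}\cdots m_r^{-k_r}$ of admissible $\mathbf k$ (with $\zeta(\emptyset)=1$), and let $\zeta:\mathfrak h^0\to\mathcal Z$ be the $\mathbb Q$-linear map with $\zeta(y_{\mathbf k})=\zeta(\mathbf k)$. Every $w\in\mathfrak h^1$ is uniquely a finite sum $\sum_a w_a\,\mathbin{\sqcup\!\sqcup}\,x_1^{\sqcup\!\sqcup\, a}$ with $w_a\in\mathfrak h^0$; set $\zeta^{\sqcup\!\sqcup}(w)=\sum_a\zeta(w_a)T^a\in\mathcal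 Z[T]$, $\zeta^{\sqcup\!\sqcup}(\mathbf k)=\zeta^{\sqcup\!\sqcup}(y_{\mathbf k})|_{T=0}$, and $$\zeta_{\mathcal S}(\mathbf k)=\sum_{a=0}^r(-1)^{k_1+\cdots+k_a}\zeta^{\sqcup\!\sqcup}(k_a,\dots,k_1)\,\zeta^{\sqcup\!\sqcup}(k_{a+1},\dots,k_r)\ \bmod\ \zeta(2)\mathcal Z\ \in\ \mathcal Z/\zeta(2)\mathcal Z .$$ For $r\ge 2$ let $$\omega_n(\mathbf k;q)=\sum_{\substack{m_1+\cdots+m_r=n\\ m_a>0}}\ \prod_{a=1}^r\frac{q^{(k_a-1)m_a}}{[m_a]^{k_a}},\quad [m]=1+q+\cdots+q^{m-1},\qquad \Omega(\mathbf k)=\lim_{n\to\infty}\omega_n(\mathbf k;e^{2\pi i/n}),$$ and $\omega_{\mathcal S}(\mathbf k)=\Omega(\mathbf k)\bmod\zeta(2)\mathcal Z$. For $\bullet\in\{\mathcal A,\mathcal S\}$ extend $\zeta_\bullet$ to $\mathfrak h^1$ by $\mathbb Q$-linearity, $\zeta_\bullet(y_{\mathbf k})=\zeta_\bullet(\mathbf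 k)$, and let $\mathcal Z^{\bullet,\omega}_w$ be the $\mathbb Q$-span of the $\omega_\bullet(\mathbf k)$ with $r\ge2$ and weight $w$. **Theorem.** Let $\mathbf k=(k_1,\dots,k_r)$ be an index with $r\ge2$. 1. $\displaystyle \omega_{\mathcal A}(\mathbf k)=(-1)^{k_r}\,\zeta_{\mathcal A}\big(x_0^{k_r}(y_{k_1}\mathbin{\sqcup\!\sqcup}\cdots\mathbin{\sqcup\!\sqcup}\, y_{k_{r-1}})\big)$ in $\mathcal A$. 2. The limit $\Omega(\mathbf k)$ exists and lies in $\mathcal Z$, and $\displaystyle \omega_{\mathcal S}(\mathbf k)=(-1)^{k_r}\,\zeta_{\mathcal S}\big(x_0^{k_r}(y_{k_1}\mathbin{\sqcup\!\sqcup}\cdots\mathbin{\sqcup\!\sqcup}\, y_{k_{r-1}})\big)$ in $\mathcal Z/\zeta(2)\mathcal Z$. 3. Consequently, if $\ker\zeta_{\mathcal A}=\ker\zeta_{\mathcal S}$ on $\mathfrak h^1$, and in particular if the Kaneko–Zagier conjecture holds (that is, $\zeta_{\mathcal A}(\mathbf k)\mapsto\zeta_{\mathcal S}(\mathbf k)$,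 for all indices $\mathbf k$, is a well-defined isomorphism of $\mathbb Q$-algebras $\mathcal Z^{\mathcal A}\to\mathcal Z/\zeta(2)\mathcal Z$), then for every $w\ge1$ the assignment $\omega_{\mathcal A}(\mathbf k)\mapsto\omega_{\mathcal S}(\mathbf k)$, for all indices $\mathbf k$ of weight $w$ and length at least $2$, is a well-defined isomorphism of $\mathbb Q$-vector spaces $\mathcal Z^{\mathcal A,\omega}_w\to\mathcal Z^{\mathcal S,\omega}_w$. -/

import Mathlib

open Filter Topology

noncomputable section

namespace OmegaValue

/-! ### Indices -/

/-- An index is a finite tuple of positive integers. -/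
abbrev Index : Type := List ℕ+

/-- The weight `k₁ + ⋯ + k_r`. -/
def weight (k : Index) : ℕ := (k.map fun a : ℕ+ => (a : ℕ)).sum

/-- The empty index is admissible; a nonempty one is if `k₁ ≥ 2`. -/
def Admissible : Index → Prop
  | [] => True
  | a :: _ => 2 ≤ a

/-! ### The ring `𝒜 = (∏ₚ 𝔽ₚ) / (⨁ₚ 𝔽ₚ)` -/

instance factPrime (p : Nat.Primes) : Fact (p : ℕ).Prime := ⟨p.2⟩

/-- The ideal `⨁ₚ 𝔽ₚ` of `∏ₚ 𝔽ₚ`. -/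
def directSumIdeal : Ideal (∀ p : Nat.Primes, ZMod p) where
  carrier := {a | {p | a p ≠ 0}.Finite}
  add_mem' := by
    intro a b ha hb
    refine (ha.union hb).subset fun p hp => ?_
    by_contra h
    simp only [Set.mem_union, Set.mem_ofPred_eq, not_or, not_not] at h
    exact hp (by simp [h.1, h.2])
  zero_mem' := by simp
  smul_mem' := by
    intro c a ha
    refine Set.Finite.subset ha fun p hp h => hp ?_
    simp [h]

/-- The ring `𝒜`. -/
def RingA : Type := (∀ p : Nat.Primes, ZMod p) ⧸ directSumIdeal

instance : CommRing RingA :=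
  inferInstanceAs (CommRing ((∀ p : Nat.Primes, ZMod p) ⧸ directSumIdeal))

/-- The class `(a_p)_p` in `𝒜`. -/
def RingA.mk : (∀ p : Nat.Primes, ZMod p) →+* RingA := Ideal.Quotient.mk directSumIdeal

theorem RingA.mk_eq_of_finite {a b : ∀ p : Nat.Primes, ZMod p}
    (h : {p | a p ≠ b p}.Finite) : RingA.mk a = RingA.mk b := by
  refine Ideal.Quotient.eq.mpr ?_
  change {p | (a - b) p ≠ 0}.Finite
  simpa [sub_eq_zero] using h

theorem finite_primes_dvd {n : ℕ} (hn : n ≠ 0) :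
    {p : Nat.Primes | (n : ZMod p) = 0}.Finite := by
  refine Set.Finite.of_finite_image (f := fun p : Nat.Primes => (p : ℕ)) ?_
    (fun a _ b _ h => Subtype.ext h)
  refine (Set.finite_Iic n).subset ?_
  rintro _ ⟨p, hp, rfl⟩
  exact Nat.le_of_dvd (Nat.pos_of_ne_zero hn) ((ZMod.natCast_eq_zero_iff n p).1 hp)

/-- The embedding of `ℚ` into `𝒜`: `a ↦ (a mod p)_p`. In Lean, the reduction `(a : ZMod p)` of a
rational number is `num / den`, which is `0` if `p` divides the denominator. -/
def ratToA : ℚ →+* RingA where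
  toFun a := RingA.mk fun p => (a : ZMod p)
  map_one' := by
    rw [← map_one RingA.mk]; congr 1; funext p; simp
  map_zero' := by
    rw [← map_zero RingA.mk]; congr 1; funext p; simp
  map_add' a b := by
    rw [← map_add]
    refine RingA.mk_eq_of_finite (((finite_primes_dvd a.den_nz).union
      (finite_primes_dvd b.den_nz)).subset fun p hp => ?_)
    by_contra h
    simp only [Set.mem_union, Set.mem_ofPred_eq, not_or] at h
    exact hp (Rat.cast_add_of_ne_zero h.1 h.2)
  map_mul' a b := by
    rw [← map_mul]
    refine RingA.mk_eq_of_finite (((finite_primes_dvd a.den_nz).union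
      (finite_primes_dvd b.den_nz)).subset fun p hp => ?_)
    by_contra h
    simp only [Set.mem_union, Set.mem_ofPred_eq, not_or] at h
    exact hp (Rat.cast_mul_of_ne_zero h.1 h.2)

instance : Algebra ℚ RingA := ratToA.toAlgebra

/-! ### Multiple harmonic sums -/

/-- The multiple harmonic sum `∑_{n > m₁ > ⋯ > m_r > 0} 1 / (m₁^{k₁} ⋯ m_r^{k_r})`, as an element
of a field, summed over `m₁` first. -/
def harmonicSum (K : Type) [Field K] : Index → ℕ → K
  | [], _ => 1
  | a :: k, n => ∑ m ∈ Finset.Ico 1 n, ((m : K) ^ (a : ℕ))⁻¹ * harmonicSum K k m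

/-- The harmonic (stuffle) product of two indices, as a list of indices. -/
def stuffle : Index → Index → List Index
  | [], l => [l]
  | a :: k, [] => [a :: k]
  | a :: k, b :: l =>
    ((stuffle k (b :: l)).map (a :: ·)) ++ ((stuffle (a :: k) l).map (b :: ·)) ++
      ((stuffle k l).map ((a + b) :: ·))
termination_by k l => k.length + l.length

theorem harmonicSum_cons_succ (K : Type) [Field K] (a : ℕ+) (k : Index) (n : ℕ) :
    harmonicSum K (a :: k) (n + 1) =
      harmonicSum K (a :: k) n + ((n : K) ^ (a : ℕ))⁻¹ * harmonicSum K k n := by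
  rcases Nat.eq_zero_or_pos n with rfl | hn
  · simp [harmonicSum]
  · simp only [harmonicSum]
    rw [Finset.sum_Ico_succ_top hn]

theorem harmonicSum_map_succ (K : Type) [Field K] (a : ℕ+) (L : List Index) (n : ℕ) :
    ((L.map (a :: ·)).map fun k => harmonicSum K k (n + 1)).sum =
      ((L.map (a :: ·)).map fun k => harmonicSum K k n).sum +
        ((n : K) ^ (a : ℕ))⁻¹ * (L.map fun k => harmonicSum K k n).sum := by
  induction L with
  | nil => simp
  | cons k L ih =>
    simp only [List.map_cons, List.sum_cons] at ih ⊢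
    rw [ih, harmonicSum_cons_succ]
    ring

theorem harmonicSum_map_zero (K : Type) [Field K] (a : ℕ+) (L : List Index) :
    ((L.map (a :: ·)).map fun k => harmonicSum K k 0).sum = 0 := by
  induction L with
  | nil => simp
  | cons k L ih =>
    simp only [List.map_cons, List.sum_cons] at ih ⊢
    rw [ih]
    simp [harmonicSum]

theorem harmonicSum_mul (K : Type) [Field K] (k l : Index) (n : ℕ) :
    harmonicSum K k n * harmonicSum K l n =
      ((stuffle k l).map fun j => harmonicSum K j n).sum := by
  match k, l with
  | [], l => simp [stuffle, harmonicSum]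
  | a :: k, [] => simp [stuffle, harmonicSum]
  | a :: k, b :: l =>
    induction n with
    | zero =>
      rw [stuffle]
      simp only [List.map_append, List.sum_append, harmonicSum_map_zero]
      simp [harmonicSum]
    | succ n ih =>
      have h1 := harmonicSum_mul K k (b :: l) n
      have h2 := harmonicSum_mul K (a :: k) l n
      have h3 := harmonicSum_mul K k l n
      rw [stuffle] at ih ⊢
      simp only [List.map_append, List.sum_append, harmonicSum_map_succ] at ih ⊢
      rw [← h1, ← h2, ← h3, harmonicSum_cons_succ, harmonicSum_cons_succ, PNat.add_coe, pow_add,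
        mul_inv]
      linear_combination ih
termination_by k.length + l.length

/-! ### Finite multiple zeta values -/

theorem cast_harmonicSum (p : ℕ) [Fact p.Prime] (k : Index) (n : ℕ) (hn : n ≤ p) :
    (((harmonicSum ℚ k n).den : ZMod p) ≠ 0) ∧
      ((harmonicSum ℚ k n : ℚ) : ZMod p) = harmonicSum (ZMod p) k n := by
  have dvd_ne : ∀ {a b : ℕ}, a ∣ b → (b : ZMod p) ≠ 0 → (a : ZMod p) ≠ 0 := by
    rintro a b ⟨c, rfl⟩ h h0
    exact h (by rw [Nat.cast_mul, h0, zero_mul])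
  induction k generalizing n with
  | nil => simp [harmonicSum]
  | cons a k ihk =>
    induction n with
    | zero => simp [harmonicSum]
    | succ n ihn =>
      obtain ⟨h1, h2⟩ := ihn (by omega)
      obtain ⟨h3, h4⟩ := ihk n (by omega)
      rw [harmonicSum_cons_succ, harmonicSum_cons_succ]
      rcases Nat.eq_zero_or_pos n with rfl | hpos
      · simpa [h2] using h1
      have hn0 : ((n ^ (a : ℕ) : ℕ) : ZMod p) ≠ 0 := by
        rw [Nat.cast_pow]
        refine pow_ne_zero _ fun h => ?_
        have := Nat.le_of_dvd hpos ((ZMod.natCast_eq_zero_iff n p).1 h)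
        omega
      have hc : (((n : ℚ) ^ (a : ℕ))⁻¹).den = n ^ (a : ℕ) := by
        have := Rat.inv_natCast_den_of_pos (a := n ^ (a : ℕ)) (by positivity)
        simpa using this
      have h5 : ((((n : ℚ) ^ (a : ℕ))⁻¹).den : ZMod p) ≠ 0 := by rw [hc]; exact hn0
      have h6 : (((((n : ℚ) ^ (a : ℕ))⁻¹ : ℚ)) : ZMod p) = ((n : ZMod p) ^ (a : ℕ))⁻¹ := by
        have h7 := Rat.cast_inv_of_ne_zero (α := ZMod p) (q := ((n ^ (a : ℕ) : ℕ) : ℚ))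
          (by simpa using hn0)
        simpa using h7
      have h8 : (((((n : ℚ) ^ (a : ℕ))⁻¹ * harmonicSum ℚ k n).den : ℕ) : ZMod p) ≠ 0 := by
        refine dvd_ne (Rat.mul_den_dvd _ _) ?_
        rw [Nat.cast_mul]
        exact mul_ne_zero h5 h3
      refine ⟨?_, ?_⟩
      · refine dvd_ne (Rat.add_den_dvd _ _) ?_
        rw [Nat.cast_mul]
        exact mul_ne_zero h1 h8
      · rw [Rat.cast_add_of_ne_zero h1 h8, Rat.cast_mul_of_ne_zero h5 h3, h2, h4, h6]

/-- The finite multiple zeta value `ζ_𝒜(k) = (H_p(k) mod p)_p`. -/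
def zetaA (k : Index) : RingA := RingA.mk fun p => ((harmonicSum ℚ k p : ℚ) : ZMod p)

theorem zetaA_mul (k l : Index) : zetaA k * zetaA l = ((stuffle k l).map zetaA).sum := by
  have h : ∀ L : List Index, (L.map zetaA).sum =
      RingA.mk fun p => (L.map fun j => harmonicSum (ZMod p) j p).sum := by
    intro L
    induction L with
    | nil => simp only [List.map_nil, List.sum_nil]; exact (map_zero RingA.mk).symm
    | cons j L ih =>
      simp only [List.map_cons, List.sum_cons]
      rw [ih, zetaA, ← map_add]
      congr 1
      funext p
      simp [(cast_harmonicSum p j p le_rfl).2]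
  rw [h, zetaA, zetaA, ← map_mul]
  congr 1
  funext p
  simp [(cast_harmonicSum p _ p le_rfl).2, harmonicSum_mul]

/-- The `ℚ`-algebra `𝒵^𝒜`: the `ℚ`-span of all finite multiple zeta values. -/
def algZA : Subalgebra ℚ RingA :=
  (Submodule.span ℚ (Set.range zetaA)).toSubalgebra
    (Submodule.subset_span ⟨[], by
      rw [zetaA, ← map_one RingA.mk]; congr 1; funext p; simp [harmonicSum]⟩)
    (by
      intro x y hx hy
      have h := Submodule.mul_mem_mul hx hy
      rw [Submodule.span_mul_span] at h
      refine Submodule.span_le.2 ?_ h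
      rintro _ ⟨_, ⟨k, rfl⟩, _, ⟨l, rfl⟩, rfl⟩
      simp only [zetaA_mul]
      refine list_sum_mem fun z hz => ?_
      obtain ⟨j, -, rfl⟩ := List.mem_map.1 hz
      exact Submodule.subset_span ⟨j, rfl⟩)

theorem zetaA_mem (k : Index) : zetaA k ∈ algZA := Submodule.subset_span ⟨k, rfl⟩

/-! ### Multiple zeta values -/

/-- The multiple zeta value `∑_{m₁ > ⋯ > m_r > 0} 1 / (m₁^{k₁} ⋯ m_r^{k_r})`, summed over `m = m₁`
last (all terms are nonnegative, and the term `m = 0` vanishes). It is used for admissible indices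
only. -/
def mzv : Index → ℝ
  | [] => 1
  | a :: k => ∑' m : ℕ, ((m : ℝ) ^ (a : ℕ))⁻¹ * harmonicSum ℝ k m

theorem harmonicSum_nonneg (k : Index) (n : ℕ) : 0 ≤ harmonicSum ℝ k n := by
  induction k generalizing n with
  | nil => simp [harmonicSum]
  | cons a k ih => exact Finset.sum_nonneg fun m _ => mul_nonneg (by positivity) (ih m)

theorem harmonicSum_le (k : Index) (n N : ℕ) (h : n ≤ N) :
    harmonicSum ℝ k n ≤ (1 + Real.log N) ^ k.length := by
  induction k generalizing n with
  | nil => simp [harmonicSum]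
  | cons a k ih =>
    have hlog : 0 ≤ 1 + Real.log N := by
      have := Real.log_natCast_nonneg N
      linarith
    calc harmonicSum ℝ (a :: k) n
        ≤ ∑ m ∈ Finset.Ico 1 n, (m : ℝ)⁻¹ * (1 + Real.log N) ^ k.length := by
          refine Finset.sum_le_sum fun m hm => ?_
          obtain ⟨h1, h2⟩ := Finset.mem_Ico.1 hm
          have hm1 : (1 : ℝ) ≤ m := by exact_mod_cast h1
          refine mul_le_mul ?_ (ih m (by omega)) (harmonicSum_nonneg k m) (by positivity)
          exact inv_anti₀ (by positivity) (le_self_pow₀ hm1 a.ne_zero)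
      _ = (∑ m ∈ Finset.Ico 1 n, (m : ℝ)⁻¹) * (1 + Real.log N) ^ k.length := by
          rw [Finset.sum_mul]
      _ ≤ (1 + Real.log N) * (1 + Real.log N) ^ k.length := by
          refine mul_le_mul_of_nonneg_right ?_ (pow_nonneg hlog _)
          have h1 := harmonic_le_one_add_log N
          rw [harmonic_eq_sum_Icc] at h1
          push_cast at h1
          refine le_trans (Finset.sum_le_sum_of_subset_of_nonneg ?_ ?_) h1
          · intro m hm
            rw [Finset.mem_Ico] at hm
            rw [Finset.mem_Icc]
            omega
          · intro m _ _
            positivity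
      _ = (1 + Real.log N) ^ (a :: k).length := by
          rw [List.length_cons, pow_succ, mul_comm]

theorem summable_mzv (a : ℕ+) (ha : 2 ≤ a) (k : Index) :
    Summable fun m : ℕ => ((m : ℝ) ^ (a : ℕ))⁻¹ * harmonicSum ℝ k m := by
  set r := k.length with hr
  set e : ℝ := 1 / (2 * (r + 1)) with he
  have he0 : 0 < e := by positivity
  have hs : Summable fun m : ℕ => (1 + 1 / e) ^ r * ((m : ℝ) ^ (-(3 / 2) : ℝ)) :=
    (Real.summable_nat_rpow.2 (by norm_num)).mul_left _
  refine Summable.of_nonneg_of_le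
    (fun m => mul_nonneg (by positivity) (harmonicSum_nonneg k m)) (fun m => ?_) hs
  rcases Nat.eq_zero_or_pos m with rfl | hm
  · simp
  have hm1 : (1 : ℝ) ≤ m := by exact_mod_cast hm
  have hm0 : (0 : ℝ) < m := by linarith
  have hlog : 1 + Real.log m ≤ (1 + 1 / e) * (m : ℝ) ^ e := by
    have h1 := Real.log_le_rpow_div hm0.le he0
    have h2 := Real.one_le_rpow hm1 he0.le
    calc 1 + Real.log m ≤ (m : ℝ) ^ e + (m : ℝ) ^ e / e := add_le_add h2 h1
      _ = _ := by ring
  have hlog0 : 0 ≤ 1 + Real.log m := by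
    have := Real.log_natCast_nonneg m
    linarith
  have hH : harmonicSum ℝ k m ≤ (1 + 1 / e) ^ r * (m : ℝ) ^ (1 / 2 : ℝ) := by
    calc harmonicSum ℝ k m ≤ (1 + Real.log m) ^ r := harmonicSum_le k m m le_rfl
      _ ≤ ((1 + 1 / e) * (m : ℝ) ^ e) ^ r := pow_le_pow_left₀ hlog0 hlog r
      _ = (1 + 1 / e) ^ r * (m : ℝ) ^ (e * r) := by
          rw [mul_pow, ← Real.rpow_natCast, ← Real.rpow_natCast, ← Real.rpow_mul hm0.le]
      _ ≤ _ := by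
          refine mul_le_mul_of_nonneg_left (Real.rpow_le_rpow_of_exponent_le hm1 ?_)
            (by positivity)
          rw [he, div_mul_eq_mul_div, div_le_div_iff₀ (by positivity) (by norm_num)]
          linarith
  have h2 : ((m : ℝ) ^ (a : ℕ))⁻¹ ≤ (m : ℝ) ^ (-2 : ℝ) := by
    rw [Real.rpow_neg hm0.le]
    refine inv_anti₀ (by positivity) ?_
    have : (2 : ℕ) ≤ a := by exact_mod_cast ha
    calc (m : ℝ) ^ (2 : ℝ) = (m : ℝ) ^ (2 : ℕ) := by norm_cast
      _ ≤ _ := pow_le_pow_right₀ hm1 this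
  calc ((m : ℝ) ^ (a : ℕ))⁻¹ * harmonicSum ℝ k m
      ≤ (m : ℝ) ^ (-2 : ℝ) * ((1 + 1 / e) ^ r * (m : ℝ) ^ (1 / 2 : ℝ)) :=
        mul_le_mul h2 hH (harmonicSum_nonneg k m) (by positivity)
    _ = (1 + 1 / e) ^ r * ((m : ℝ) ^ (-2 : ℝ) * (m : ℝ) ^ (1 / 2 : ℝ)) := by ring
    _ = _ := by rw [← Real.rpow_add hm0]; norm_num

theorem tendsto_harmonicSum {k : Index} (hk : Admissible k) :
    Tendsto (harmonicSum ℝ k) atTop (𝓝 (mzv k)) := by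
  cases k with
  | nil => exact tendsto_const_nhds
  | cons a k =>
    refine (summable_mzv a hk k).hasSum.tendsto_sum_nat.congr fun n => ?_
    rw [harmonicSum, Finset.range_eq_Ico]
    rcases Nat.eq_zero_or_pos n with rfl | hn
    · simp
    · rw [Finset.sum_eq_sum_Ico_succ_bot hn]
      simp

theorem admissible_stuffle {k l : Index} (hk : Admissible k) (hl : Admissible l) :
    ∀ j ∈ stuffle k l, Admissible j := by
  intro j hj
  match k, l with
  | [], l =>
    simp only [stuffle, List.mem_singleton] at hj
    exact hj ▸ hl
  | a :: k, [] =>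
    simp only [stuffle, List.mem_singleton] at hj
    exact hj ▸ hk
  | a :: k, b :: l =>
    simp only [stuffle, List.mem_append, List.mem_map] at hj
    rcases hj with (⟨_, _, rfl⟩ | ⟨_, _, rfl⟩) | ⟨_, _, rfl⟩
    · exact hk
    · exact hl
    · exact le_trans (show (2 : ℕ+) ≤ a from hk) (PNat.coe_le_coe _ _ |>.1 (by simp))

theorem mzv_mul {k l : Index} (hk : Admissible k) (hl : Admissible l) :
    mzv k * mzv l = ((stuffle k l).map mzv).sum := by
  have h1 := (tendsto_harmonicSum hk).mul (tendsto_harmonicSum hl)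
  have h2 : ∀ L : List Index, (∀ j ∈ L, Admissible j) →
      Tendsto (fun n => (L.map fun j => harmonicSum ℝ j n).sum) atTop
        (𝓝 (L.map mzv).sum) := by
    intro L hL
    induction L with
    | nil => simp
    | cons j L ih =>
      simp only [List.map_cons, List.sum_cons]
      exact (tendsto_harmonicSum (hL j (by simp))).add (ih fun i hi => hL i (by simp [hi]))
  refine tendsto_nhds_unique h1 ((h2 _ (admissible_stuffle hk hl)).congr fun n => ?_)
  exact (harmonicSum_mul ℝ k l n).symm

/-- The `ℚ`-algebra `𝒵`: the `ℚ`-span of all multiple zeta values. -/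
def algZ : Subalgebra ℚ ℝ :=
  (Submodule.span ℚ (mzv '' {k | Admissible k})).toSubalgebra
    (Submodule.subset_span ⟨[], trivial, rfl⟩)
    (by
      intro x y hx hy
      have h := Submodule.mul_mem_mul hx hy
      rw [Submodule.span_mul_span] at h
      refine Submodule.span_le.2 ?_ h
      rintro _ ⟨_, ⟨k, hk, rfl⟩, _, ⟨l, hl, rfl⟩, rfl⟩
      simp only [mzv_mul hk hl]
      refine list_sum_mem fun z hz => ?_
      obtain ⟨j, hj, rfl⟩ := List.mem_map.1 hz
      exact Submodule.subset_span ⟨j, admissible_stuffle hk hl j hj, rfl⟩)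

theorem mzv_mem {k : Index} (hk : Admissible k) : mzv k ∈ algZ :=
  Submodule.subset_span ⟨k, hk, rfl⟩

/-- `ζ(2)` as an element of `𝒵`. -/
def zetaTwo : algZ := ⟨mzv [2], mzv_mem (le_refl (2 : ℕ+))⟩

/-- The quotient `ℚ`-algebra `𝒵 / ζ(2)𝒵`. -/
abbrev QuotZ : Type := algZ ⧸ Ideal.span {zetaTwo}

/-- The projection `𝒵 → 𝒵 / ζ(2)𝒵`. -/
def modZetaTwo : algZ →+* QuotZ := Ideal.Quotient.mk (Ideal.span {zetaTwo})

/-! ### The algebra `𝔥 = ℚ⟨x₀, x₁⟩` and the shuffle product -/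

/-- The non-commutative polynomial ring `𝔥 = ℚ⟨x₀, x₁⟩`. -/
abbrev WordAlg : Type := FreeAlgebra ℚ (Fin 2)

/-- The indeterminates `x₀` and `x₁`. -/
def x (i : Fin 2) : WordAlg := FreeAlgebra.ι ℚ i

/-- The monomial in `𝔥` given by a word in the letters `0` and `1`. -/
def word (w : List (Fin 2)) : WordAlg := (w.map x).prod

/-- The words form a linear basis of `𝔥`. -/
def wordBasis : Module.Basis (List (Fin 2)) ℚ WordAlg :=
  (FreeAlgebra.basisFreeMonoid ℚ (Fin 2)).reindex FreeMonoid.toList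

theorem wordBasis_apply (w : List (Fin 2)) : wordBasis w = word w := by
  simp only [wordBasis, FreeAlgebra.basisFreeMonoid, Module.Basis.reindex_apply]
  change FreeAlgebra.equivMonoidAlgebraFreeMonoid.symm
    (MonoidAlgebra.single (FreeMonoid.ofList w) 1) = word w
  rw [← MonoidAlgebra.of_apply]
  change MonoidAlgebra.lift ℚ _ _ (FreeMonoid.lift (FreeAlgebra.ι ℚ)) _ = word w
  rw [MonoidAlgebra.lift_of, FreeMonoid.lift_apply]
  rfl

/-- The shuffle product of two words: `uw ⧢ vw' = u(w ⧢ vw') + v(uw ⧢ w')`,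
`w ⧢ 1 = w = 1 ⧢ w`. -/
def shuffleWord : List (Fin 2) → List (Fin 2) → WordAlg
  | [], w => word w
  | u :: w, [] => word (u :: w)
  | u :: w, v :: w' => x u * shuffleWord w (v :: w') + x v * shuffleWord (u :: w) w'
termination_by w w' => w.length + w'.length

/-- The shuffle product `⧢` on `𝔥`, the bilinear extension of the shuffle product of words. -/
def shuffle : WordAlg →ₗ[ℚ] WordAlg →ₗ[ℚ] WordAlg :=
  wordBasis.constr ℚ fun w => wordBasis.constr ℚ fun w' => shuffleWord w w'

/-- `a₁ ⧢ ⋯ ⧢ a_n`. -/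
def shuffleList (L : List WordAlg) : WordAlg := L.foldr (fun a b => shuffle a b) 1

/-- `y_k = x₀^{k-1} x₁`. -/
def y (k : ℕ+) : WordAlg := x 0 ^ ((k : ℕ) - 1) * x 1

/-- `y_k = y_{k₁} ⋯ y_{k_r}` for an index `k`. -/
def yIndex (k : Index) : WordAlg := (k.map y).prod

/-- The word of the monomial `y_k`. -/
def yWord (k : Index) : List (Fin 2) :=
  (k.map fun a : ℕ+ => List.replicate ((a : ℕ) - 1) 0 ++ [1]).flatten

/-- `𝔥¹ = ℚ + 𝔥x₁`. -/
def H1 : Submodule ℚ WordAlg := 1 ⊔ LinearMap.range (LinearMap.mulRight ℚ (x 1))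

/-- `𝔥⁰ = ℚ + x₀𝔥x₁`. -/
def H0 : Submodule ℚ WordAlg :=
  1 ⊔ LinearMap.range (LinearMap.mulLeft ℚ (x 0) ∘ₗ LinearMap.mulRight ℚ (x 1))

theorem word_append (v w : List (Fin 2)) : word (v ++ w) = word v * word w := by
  simp [word]

theorem word_cons (u : Fin 2) (w : List (Fin 2)) : word (u :: w) = x u * word w := by
  simp [word]

theorem word_nil : word [] = 1 := rfl

theorem word_singleton (u : Fin 2) : word [u] = x u := by simp [word]

theorem yIndex_eq_word (k : Index) : yIndex k = word (yWord k) := by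
  induction k with
  | nil => rfl
  | cons a k ih =>
    simp only [yIndex, yWord, List.map_cons, List.prod_cons, List.flatten_cons] at ih ⊢
    rw [word_append, ← ih, word_append, word_singleton, y]
    congr 2
    simp [word]

theorem yWord_injective : Function.Injective yWord := by
  have hsplit : ∀ (m n : ℕ) (u v : List (Fin 2)),
      List.replicate m 0 ++ [1] ++ u = List.replicate n 0 ++ [1] ++ v → m = n ∧ u = v := by
    intro m
    induction m with
    | zero =>
      intro n u v h
      cases n with
      | zero => simpa using h
      | succ n => simp [List.replicate_succ] at h
    | succ m ih =>
      intro n u v h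
      cases n with
      | zero => simp [List.replicate_succ] at h
      | succ n =>
        obtain ⟨h1, h2⟩ := ih n u v (by simpa [List.replicate_succ] using h)
        exact ⟨by rw [h1], h2⟩
  intro k
  induction k with
  | nil =>
    intro l h
    cases l with
    | nil => rfl
    | cons b l => simp [yWord] at h
  | cons a k ih =>
    intro l h
    cases l with
    | nil => simp [yWord] at h
    | cons b l =>
      simp only [yWord, List.map_cons, List.flatten_cons] at h
      obtain ⟨h1, h2⟩ := hsplit _ _ _ _ h
      have h3 : a = b := by
        have := a.pos
        have := b.pos
        exact PNat.eq (by omega)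
      rw [h3, ih h2]

/-- The `ℚ`-linear extension of a function `f` of indices: the linear map with `y_k ↦ f k`. The
`y_k` form a basis of `𝔥¹`; the words not in `𝔥¹`, which are never used, are sent to `0`. -/
def linExt {M : Type} [AddCommGroup M] [Module ℚ M] (f : Index → M) : WordAlg →ₗ[ℚ] M :=
  wordBasis.constr ℚ (Function.extend yWord f 0)

theorem linExt_yIndex {M : Type} [AddCommGroup M] [Module ℚ M] (f : Index → M) (k : Index) :
    linExt f (yIndex k) = f k := by
  rw [yIndex_eq_word, ← wordBasis_apply, linExt, Module.Basis.constr_basis,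
    yWord_injective.extend_apply]

theorem yIndex_mem (k : Index) : yIndex k ∈ H1 := by
  rcases List.eq_nil_or_concat k with rfl | ⟨k, a, rfl⟩
  · exact Submodule.mem_sup_left (Submodule.one_le.1 le_rfl)
  · refine Submodule.mem_sup_right ⟨yIndex k * x 0 ^ ((a : ℕ) - 1), ?_⟩
    simp [yIndex, y, mul_assoc]

/-! ### Shuffle regularization -/

/-- `w ↦ w ⧢ x₁`. -/
def shuffleX1 : Module.End ℚ WordAlg := shuffle.flip (x 1)

theorem shuffle_word (v w : List (Fin 2)) : shuffle (word v) (word w) = shuffleWord v w := by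
  rw [← wordBasis_apply, ← wordBasis_apply, shuffle, Module.Basis.constr_basis,
    Module.Basis.constr_basis]

theorem shuffleX1_word (w : List (Fin 2)) : shuffleX1 (word w) = shuffleWord w [1] := by
  rw [← shuffle_word, word_singleton]
  rfl

theorem shuffleX1_one : shuffleX1 1 = x 1 := by
  rw [← word_nil, shuffleX1_word, shuffleWord, word_singleton]

theorem shuffleX1_mul (u : Fin 2) (w : WordAlg) :
    shuffleX1 (x u * w) = x u * shuffleX1 w + x 1 * (x u * w) := by
  suffices h : shuffleX1 ∘ₗ LinearMap.mulLeft ℚ (x u) =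
      LinearMap.mulLeft ℚ (x u) ∘ₗ shuffleX1 +
        LinearMap.mulLeft ℚ (x 1) ∘ₗ LinearMap.mulLeft ℚ (x u) from LinearMap.congr_fun h w
  refine wordBasis.ext fun v => ?_
  simp only [wordBasis_apply, LinearMap.comp_apply, LinearMap.add_apply,
    LinearMap.mulLeft_apply]
  rw [← word_cons, shuffleX1_word, shuffleX1_word, shuffleWord]
  cases v <;> simp [shuffleWord]

theorem one_mem_H0 : (1 : WordAlg) ∈ H0 := Submodule.mem_sup_left (Submodule.one_le.1 le_rfl)

theorem one_mem_H1 : (1 : WordAlg) ∈ H1 := Submodule.mem_sup_left (Submodule.one_le.1 le_rfl)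

theorem mem_H0 (w : WordAlg) : x 0 * (w * x 1) ∈ H0 := Submodule.mem_sup_right ⟨w, rfl⟩

theorem mem_H1 (w : WordAlg) : w * x 1 ∈ H1 := Submodule.mem_sup_right ⟨w, rfl⟩

theorem H0_induction {P : WordAlg → Prop} (h1 : P 1) (hx : ∀ w, P (x 0 * (w * x 1)))
    (hadd : ∀ v w, P v → P w → P (v + w)) (hs : ∀ (c : ℚ) v, P v → P (c • v)) {v : WordAlg}
    (hv : v ∈ H0) : P v := by
  obtain ⟨a, ha, b, ⟨w, rfl⟩, rfl⟩ := Submodule.mem_sup.1 hv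
  obtain ⟨c, rfl⟩ := Submodule.mem_one.1 ha
  rw [Algebra.algebraMap_eq_smul_one]
  exact hadd _ _ (hs _ _ h1) (hx w)

theorem H1_induction {P : WordAlg → Prop} (h1 : P 1) (hx : ∀ w, P (w * x 1))
    (hadd : ∀ v w, P v → P w → P (v + w)) (hs : ∀ (c : ℚ) v, P v → P (c • v)) {v : WordAlg}
    (hv : v ∈ H1) : P v := by
  obtain ⟨a, ha, b, ⟨w, rfl⟩, rfl⟩ := Submodule.mem_sup.1 hv
  obtain ⟨c, rfl⟩ := Submodule.mem_one.1 ha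
  rw [Algebra.algebraMap_eq_smul_one]
  exact hadd _ _ (hs _ _ h1) (hx w)

theorem H0_le_H1 : H0 ≤ H1 := fun v hv => by
  refine H0_induction (P := (· ∈ H1)) one_mem_H1 (fun w => ?_) (fun _ _ => H1.add_mem)
    (fun c _ => H1.smul_mem c) hv
  rw [← mul_assoc]
  exact mem_H1 _

/-- Right multiples of `x₁` are stable under `w ↦ w ⧢ x₁`. -/
theorem shuffleX1_mul_x1 (w : WordAlg) : ∃ v, shuffleX1 (w * x 1) = v * x 1 := by
  suffices h : LinearMap.range (shuffleX1 ∘ₗ LinearMap.mulRight ℚ (x 1)) ≤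
      LinearMap.range (LinearMap.mulRight ℚ (x 1)) by
    obtain ⟨v, hv⟩ := h ⟨w, rfl⟩
    exact ⟨v, hv.symm⟩
  rw [LinearMap.range_eq_map, ← wordBasis.span_eq, Submodule.map_span_le]
  rintro _ ⟨v, rfl⟩
  rw [wordBasis_apply]
  simp only [LinearMap.comp_apply, LinearMap.mulRight_apply]
  induction v with
  | nil =>
    refine ⟨x 1 + x 1, ?_⟩
    have h := shuffleX1_mul 1 1
    rw [mul_one, shuffleX1_one] at h
    rw [word_nil, one_mul, h, LinearMap.mulRight_apply, add_mul]
  | cons u v ih =>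
    obtain ⟨a, ha⟩ := ih
    rw [word_cons, mul_assoc, shuffleX1_mul, ← ha]
    refine ⟨x u * a + x 1 * (x u * word v), ?_⟩
    simp only [LinearMap.mulRight_apply, add_mul, mul_assoc]

theorem shuffleX1_mem {w : WordAlg} (hw : w ∈ H1) : shuffleX1 w ∈ H1 := by
  refine H1_induction (P := fun w => shuffleX1 w ∈ H1) ?_ (fun w => ?_) (fun _ _ hv hw => ?_)
    (fun c _ hv => ?_) hw
  · rw [shuffleX1_one]
    simpa using mem_H1 1
  · obtain ⟨v, hv⟩ := shuffleX1_mul_x1 w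
    rw [hv]
    exact mem_H1 v
  · rw [map_add]
    exact H1.add_mem hv hw
  · rw [map_smul]
    exact H1.smul_mem c hv

theorem pow_shuffleX1_mem (i : ℕ) {w : WordAlg} (hw : w ∈ H1) : (shuffleX1 ^ i) w ∈ H1 := by
  induction i with
  | zero => simpa using hw
  | succ i ih =>
    rw [pow_succ', Module.End.mul_apply]
    exact shuffleX1_mem ih

/-- The map `(w₀, w₁, …) ↦ w₀ + w₁ ⧢ x₁ + w₂ ⧢ x₁ ⧢ x₁ + ⋯` from finitely supported sequences in
`𝔥⁰` to `𝔥`. -/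
def fromPoly : (ℕ →₀ H0) →ₗ[ℚ] WordAlg :=
  Finsupp.lsum ℚ fun i => (shuffleX1 ^ i) ∘ₗ H0.subtype

theorem fromPoly_apply (c : ℕ →₀ H0) :
    fromPoly c = c.sum fun i w => (shuffleX1 ^ i) (w : WordAlg) := rfl

theorem fromPoly_mem (c : ℕ →₀ H0) : fromPoly c ∈ H1 :=
  H1.sum_mem fun i _ => pow_shuffleX1_mem i (H0_le_H1 (c i).2)

/-- The linear map removing a leading `x₁`. -/
def dropX1 : WordAlg →ₗ[ℚ] WordAlg :=
  wordBasis.constr ℚ fun w => match w with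
    | [] => 0
    | u :: w => if u = 1 then word w else 0

theorem dropX1_word_cons (u : Fin 2) (w : List (Fin 2)) :
    dropX1 (word (u :: w)) = if u = 1 then word w else 0 := by
  rw [← wordBasis_apply, dropX1, Module.Basis.constr_basis]

theorem dropX1_one : dropX1 1 = 0 := by
  rw [← word_nil, ← wordBasis_apply, dropX1, Module.Basis.constr_basis]

theorem dropX1_mul (u : Fin 2) (w : WordAlg) :
    dropX1 (x u * w) = if u = 1 then w else 0 := by
  suffices h : dropX1 ∘ₗ LinearMap.mulLeft ℚ (x u) =
      if u = 1 then LinearMap.id else 0 by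
    have := LinearMap.congr_fun h w
    split_ifs at this ⊢ <;> simpa using this
  refine wordBasis.ext fun v => ?_
  rw [wordBasis_apply, LinearMap.comp_apply, LinearMap.mulLeft_apply, ← word_cons,
    dropX1_word_cons]
  split_ifs <;> simp

theorem dropX1_H0 {w : WordAlg} (hw : w ∈ H0) : dropX1 w = 0 := by
  refine H0_induction (P := fun w => dropX1 w = 0) dropX1_one (fun w => ?_)
    (fun _ _ hv hw => ?_) (fun c _ hv => ?_) hw
  · simp [dropX1_mul]
  · rw [map_add, hv, hw, add_zero]
  · rw [map_smul, hv, smul_zero]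

theorem dropX1_shuffleX1 (w : WordAlg) :
    dropX1 (shuffleX1 w) = w + shuffleX1 (dropX1 w) := by
  suffices h : dropX1 ∘ₗ shuffleX1 = LinearMap.id + shuffleX1 ∘ₗ dropX1 from
    LinearMap.congr_fun h w
  refine wordBasis.ext fun v => ?_
  simp only [wordBasis_apply, LinearMap.comp_apply, LinearMap.add_apply, LinearMap.id_apply]
  cases v with
  | nil =>
    rw [word_nil, shuffleX1_one, dropX1_one, map_zero, ← mul_one (x 1), dropX1_mul]
    simp
  | cons u v =>
    rw [word_cons, shuffleX1_mul, map_add, dropX1_mul, dropX1_mul, dropX1_mul, if_pos rfl]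
    split_ifs <;> simp [add_comm]

theorem dropX1_pow_shuffleX1 (i : ℕ) {w : WordAlg} (hw : w ∈ H0) :
    dropX1 ((shuffleX1 ^ (i + 1)) w) = (i + 1 : ℚ) • (shuffleX1 ^ i) w := by
  induction i with
  | zero => simp [dropX1_shuffleX1, dropX1_H0 hw]
  | succ i ih =>
    rw [pow_succ', Module.End.mul_apply, dropX1_shuffleX1, ih, map_smul, ← Module.End.mul_apply,
      ← pow_succ']
    push_cast
    module

theorem pow_dropX1_pow_shuffleX1 (n i : ℕ) (hi : i ≤ n) {w : WordAlg} (hw : w ∈ H0) :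
    (dropX1 ^ n) ((shuffleX1 ^ i) w) = if i = n then (n.factorial : ℚ) • w else 0 := by
  induction n generalizing i with
  | zero =>
    obtain rfl : i = 0 := by omega
    simp
  | succ n ih =>
    rw [pow_succ, Module.End.mul_apply]
    cases i with
    | zero => simp [dropX1_H0 hw]
    | succ i =>
      rw [dropX1_pow_shuffleX1 i hw, map_smul, ih i (by omega)]
      by_cases h : i = n
      · subst h
        simp [Nat.factorial_succ, smul_smul]
      · simp [h]

theorem fromPoly_eq_zero {c : ℕ →₀ H0} (hc : fromPoly c = 0) : c = 0 := by
  by_contra hne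
  have hs : c.support.Nonempty := Finsupp.support_nonempty_iff.2 hne
  set n := c.support.max' hs with hn
  have h := congrArg (dropX1 ^ n) hc
  rw [fromPoly_apply, Finsupp.sum, map_sum, map_zero, Finset.sum_eq_single n] at h
  · rw [pow_dropX1_pow_shuffleX1 n n le_rfl (c n).2, if_pos rfl] at h
    have h2 : ((c n : H0) : WordAlg) = 0 :=
      (smul_eq_zero.1 h).resolve_left (by exact_mod_cast n.factorial_ne_zero)
    exact Finsupp.mem_support_iff.1 (c.support.max'_mem hs) (Subtype.ext h2)
  · intro i hi hin
    rw [pow_dropX1_pow_shuffleX1 n i (c.support.le_max' i hi) (c i).2, if_neg hin]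
  · intro hnot
    exact absurd (c.support.max'_mem hs) hnot

theorem fromPoly_injective : Function.Injective fromPoly := by
  intro c d h
  have h1 : fromPoly (c + (-1 : ℚ) • d) = 0 := by
    rw [map_add, map_smul, h]
    module
  have h2 := fromPoly_eq_zero h1
  calc c = (c + (-1 : ℚ) • d) + d := by module
    _ = d := by rw [h2, zero_add]

theorem shuffleX1_fromPoly (c : ℕ →₀ H0) : ∃ d, shuffleX1 (fromPoly c) = fromPoly d := by
  induction c using Finsupp.induction_linear with
  | zero => exact ⟨0, by simp⟩
  | add c d hc hd =>
    obtain ⟨c', hc⟩ := hc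
    obtain ⟨d', hd⟩ := hd
    exact ⟨c' + d', by rw [map_add, map_add, map_add, hc, hd]⟩
  | single i w =>
    refine ⟨Finsupp.single (i + 1) w, ?_⟩
    rw [fromPoly_apply, fromPoly_apply, Finsupp.sum_single_index (by simp),
      Finsupp.sum_single_index (by simp), pow_succ', Module.End.mul_apply]

/-- `x₁ⁿv ⧢ x₁ = n x₁ⁿ⁺¹v + x₁ⁿ(v ⧢ x₁)`. -/
theorem shuffleX1_pow_mul (n : ℕ) (v : WordAlg) :
    shuffleX1 (x 1 ^ n * v) = (n : ℚ) • (x 1 ^ (n + 1) * v) + x 1 ^ n * shuffleX1 v := by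
  induction n with
  | zero => simp
  | succ n ih =>
    rw [pow_succ' (x 1) n, mul_assoc, shuffleX1_mul, ih, mul_add, mul_smul_comm, ← mul_assoc,
      ← pow_succ', ← mul_assoc (x 1) (x 1 ^ n), ← pow_succ', ← mul_assoc (x 1) (x 1 ^ n),
      ← pow_succ', ← mul_assoc (x 1) (x 1 ^ (n + 1)), ← pow_succ']
    push_cast
    module

theorem shuffleX1_H0 {v : WordAlg} (hv : v ∈ H0) : ∃ v' ∈ H0, shuffleX1 v = x 1 * v + v' := by
  refine H0_induction (P := fun v => ∃ v' ∈ H0, shuffleX1 v = x 1 * v + v') ?_ (fun w => ?_)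
    ?_ ?_ hv
  · exact ⟨0, H0.zero_mem, by rw [shuffleX1_one]; simp⟩
  · obtain ⟨a, ha⟩ := shuffleX1_mul_x1 w
    exact ⟨_, mem_H0 a, by rw [shuffleX1_mul, ha, add_comm]⟩
  · rintro v w ⟨v', hv', hv⟩ ⟨w', hw', hw⟩
    exact ⟨v' + w', H0.add_mem hv' hw', by rw [map_add, hv, hw, mul_add]; abel⟩
  · rintro c v ⟨v', hv', hv⟩
    exact ⟨c • v', H0.smul_mem c hv', by rw [map_smul, hv, smul_add, mul_smul_comm]⟩

theorem pow_mul_mem_range (n : ℕ) {v : WordAlg} (hv : v ∈ H0) :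
    x 1 ^ n * v ∈ LinearMap.range fromPoly := by
  induction n generalizing v with
  | zero =>
    refine ⟨Finsupp.single 0 ⟨v, hv⟩, ?_⟩
    rw [fromPoly_apply, Finsupp.sum_single_index (by simp)]
    simp
  | succ n ih =>
    obtain ⟨v', hv', h1⟩ := shuffleX1_H0 hv
    have h2 := shuffleX1_pow_mul n v
    rw [h1, mul_add, ← mul_assoc, ← pow_succ] at h2
    have h3 : x 1 ^ (n + 1) * v =
        ((n : ℚ) + 1)⁻¹ • (shuffleX1 (x 1 ^ n * v) - x 1 ^ n * v') := by
      have hne : (n : ℚ) + 1 ≠ 0 := by positivity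
      rw [eq_inv_smul_iff₀ hne, h2]
      module
    rw [h3]
    refine Submodule.smul_mem _ _ (Submodule.sub_mem _ ?_ (ih hv'))
    obtain ⟨c, hc⟩ := ih hv
    obtain ⟨d, hd⟩ := shuffleX1_fromPoly c
    exact ⟨d, by rw [← hd, hc]⟩

theorem H1_le_range : H1 ≤ LinearMap.range fromPoly := fun v hv => by
  refine H1_induction (P := (· ∈ LinearMap.range fromPoly))
    (by simpa using pow_mul_mem_range 0 one_mem_H0) (fun w => ?_)
    (fun _ _ => Submodule.add_mem _) (fun c _ => Submodule.smul_mem _ c) hv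
  suffices h : LinearMap.range (LinearMap.mulRight ℚ (x 1)) ≤ LinearMap.range fromPoly from
    h ⟨w, rfl⟩
  rw [LinearMap.range_eq_map, ← wordBasis.span_eq, Submodule.map_span_le]
  rintro _ ⟨v, rfl⟩
  rw [wordBasis_apply, LinearMap.mulRight_apply]
  have key : ∀ n : ℕ, x 1 ^ n * (word v * x 1) ∈ LinearMap.range fromPoly := by
    induction v with
    | nil =>
      intro n
      have h := pow_mul_mem_range (n + 1) one_mem_H0
      rwa [mul_one, pow_succ, ← one_mul (x 1 ^ n * x 1), ← mul_assoc, one_mul,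
        ← mul_one (x 1 ^ n), mul_assoc, ← word_nil] at h
    | cons u v ih =>
      intro n
      rw [word_cons, mul_assoc]
      match u with
      | 0 => exact pow_mul_mem_range n (mem_H0 _)
      | 1 =>
        rw [← mul_assoc, ← pow_succ]
        exact ih (n + 1)
  simpa using key 0

/-- The isomorphism `𝔥⁰[x₁] ≅ 𝔥¹`: every element of `𝔥¹` is uniquely of the form
`w₀ + w₁ ⧢ x₁ + w₂ ⧢ x₁ ⧢ x₁ + ⋯` with `w_i ∈ 𝔥⁰`. -/
def polyEquiv : (ℕ →₀ H0) ≃ₗ[ℚ] H1 :=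
  LinearEquiv.ofBijective (fromPoly.codRestrict H1 fromPoly_mem)
    ⟨fun _ _ h => fromPoly_injective (congrArg Subtype.val h), fun w => by
      obtain ⟨c, hc⟩ := H1_le_range w.2
      exact ⟨c, Subtype.ext hc⟩⟩

open Classical in
/-- The `ℚ`-linear map `ζ : 𝔥⁰ → 𝒵` with `ζ(y_k) = ζ(k)` for admissible `k`. -/
def zetaH0 : H0 →ₗ[ℚ] algZ :=
  (linExt fun k => if h : Admissible k then (⟨mzv k, mzv_mem h⟩ : algZ) else 0).domRestrict H0

/-- The map `ζ^⧢ : 𝔥¹ → 𝒵[T]`, `w₀ + w₁ ⧢ x₁ + w₂ ⧢ x₁ ⧢ x₁ + ⋯ ↦ ∑ ζ(w_i) Tⁱ`. -/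
def zetaShPoly : H1 →ₗ[ℚ] Polynomial algZ :=
  (Finsupp.lsum ℚ fun i => (Polynomial.monomial i).restrictScalars ℚ ∘ₗ zetaH0) ∘ₗ
    polyEquiv.symm.toLinearMap

/-- The shuffle regularized multiple zeta value `ζ^⧢(k) = ζ^⧢(y_k)|_{T=0}`. -/
def zetaSh (k : Index) : algZ := (zetaShPoly ⟨yIndex k, yIndex_mem k⟩).eval 0

/-- `ζ_𝒮^⧢(k) = ∑_{a=0}^r (-1)^{k₁+⋯+k_a} ζ^⧢(k_a, …, k₁) ζ^⧢(k_{a+1}, …, k_r)`. -/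
def zetaSSh (k : Index) : algZ :=
  ∑ a ∈ Finset.range (k.length + 1),
    (-1) ^ weight (k.take a) * zetaSh (k.take a).reverse * zetaSh (k.drop a)

/-- The symmetric multiple zeta value `ζ_𝒮(k) = ζ_𝒮^⧢(k) mod ζ(2)𝒵`. -/
def zetaS (k : Index) : QuotZ := modZetaTwo (zetaSSh k)

/-- The Kaneko-Zagier conjecture: `ζ_𝒜(k) ↦ ζ_𝒮(k)` is a well-defined isomorphism of
`ℚ`-algebras `𝒵^𝒜 → 𝒵 / ζ(2)𝒵`. -/
def KanekoZagierConjecture : Prop :=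
  ∃ φ : algZA ≃ₐ[ℚ] QuotZ, ∀ k : Index, φ ⟨zetaA k, zetaA_mem k⟩ = zetaS k

/-! ### Multiple omega values -/

/-- The tuples `(m₁, …, m_r)` of positive integers with `m₁ + ⋯ + m_r = n`. -/
def positiveTuples (r n : ℕ) : Finset (Fin r → ℕ) :=
  (Finset.univ.piAntidiag n).filter fun m => ∀ a, 0 < m a

/-- `ω_n(k) = ∑_{m₁+⋯+m_r=n, m_a>0} ∏_a 1 / m_a^{k_a}`. -/
def omegaN (n : ℕ) (k : Index) : ℚ :=
  ∑ m ∈ positiveTuples k.length n, ∏ a, 1 / (m a : ℚ) ^ (k.get a : ℕ)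

/-- The finite multiple omega value `ω_𝒜(k) = (ω_p(k) mod p)_p`. -/
def omegaA (k : Index) : RingA := RingA.mk fun p => ((omegaN p k : ℚ) : ZMod p)

/-- The `q`-integer `[m] = 1 + q + ⋯ + q^{m-1}`. -/
def qInt (q : ℂ) (m : ℕ) : ℂ := ∑ i ∈ Finset.range m, q ^ i

/-- `ω_n(k; q) = ∑_{m₁+⋯+m_r=n, m_a>0} ∏_a q^{(k_a-1)m_a} / [m_a]^{k_a}`. -/
def omegaQ (n : ℕ) (k : Index) (q : ℂ) : ℂ :=
  ∑ m ∈ positiveTuples k.length n,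
    ∏ a, q ^ (((k.get a : ℕ) - 1) * m a) / qInt q (m a) ^ (k.get a : ℕ)

/-- The sequence `ω_n(k; e^{2πi/n})`. -/
def omegaRoot (k : Index) (n : ℕ) : ℂ :=
  omegaQ n k (Complex.exp (2 * Real.pi * Complex.I / n))

/-- `Ω(k) = lim_{n → ∞} ω_n(k; e^{2πi/n})`. -/
def Omega (k : Index) : ℂ := limUnder atTop (omegaRoot k)

open Classical in
/-- The symmetric multiple omega value `ω_𝒮(k) = Ω(k) mod ζ(2)𝒵` (where `Ω(k) ∈ 𝒵`). -/
def omegaS (k : Index) : QuotZ :=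
  if h : ∃ z : algZ, ((z : ℝ) : ℂ) = Omega k then modZetaTwo h.choose else 0

/-- `𝒵_w^{𝒜,ω}`: the `ℚ`-span of the finite multiple omega values of weight `w`. -/
def spaceOmegaA (w : ℕ) : Submodule ℚ RingA :=
  Submodule.span ℚ (omegaA '' {k | 2 ≤ k.length ∧ weight k = w})

/-- `𝒵_w^{𝒮,ω}`: the `ℚ`-span of the symmetric multiple omega values of weight `w`. -/
def spaceOmegaS (w : ℕ) : Submodule ℚ QuotZ :=
  Submodule.span ℚ (omegaS '' {k | 2 ≤ k.length ∧ weight k = w})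

/-- The analogue of the Kaneko-Zagier conjecture for multiple omega values: for every `w ≥ 1`,
`ω_𝒜(k) ↦ ω_𝒮(k)` is a well-defined isomorphism of `ℚ`-vector spaces
`𝒵_w^{𝒜,ω} → 𝒵_w^{𝒮,ω}`. -/
def OmegaConjecture : Prop :=
  ∀ w : ℕ, 1 ≤ w → ∃ φ : spaceOmegaA w ≃ₗ[ℚ] spaceOmegaS w,
    ∀ (k : Index) (hk : 2 ≤ k.length ∧ weight k = w),
      φ ⟨omegaA k, Submodule.subset_span ⟨k, hk, rfl⟩⟩ =
        ⟨omegaS k, Submodule.subset_span ⟨k, hk, rfl⟩⟩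

/-- `x₀^{k_r} (y_{k₁} ⧢ ⋯ ⧢ y_{k_{r-1}})` for a nonempty index `k = (k₁, …, k_r)`. -/
def omegaWord (k : Index) (hk : k ≠ []) : WordAlg :=
  x 0 ^ (k.getLast hk : ℕ) * shuffleList (k.dropLast.map y)

end OmegaValue

end

/-!
The three parts rest on one computation: the sum `ω_n(k)` is the coefficient of `t^n` in the product
of the polylogarithms `Li_{k_a}(t) = ∑ t^m / m^{k_a}`, and polylogarithms multiply by the shuffle
product (`polylog_shuffle`, proved from the differential equations). Hence `ω_n(k)` is the `n`-th
coefficient of `Li` at `y_{k₁} ⧢ ⋯ ⧢ y_{k_r}` (`coeff_polylog_shuffleList`); a further factor `x₀^l`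
on the left divides that coefficient by `n^l`, and summing the coefficients below `n` gives the
multiple harmonic sums `H_n` (`linExt_harmonicSum`).

*Finite side.* In `ω_p(k)` write `m_r = p - n`. Then `m_r ≡ -n` modulo `p`, and
`ω_p(k) ≡ (-1)^{k_r} ∑_{n<p} n^{-k_r} ω_n(k₁, …, k_{r-1})`, which is the claim.

*The limit.* At `q = e^{2πi/n}` the summands of `ω_n(k; q)` are dominated by a summable family as
soon as the sum is cut into the parts where a given entry `m_j` is a largest one. In the `j`-th part
the other entries stay bounded in the limit and `[m_j] = -q^{-s}[s]` with `s` the sum of the other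
entries, so the part tends to
`(-1)^{k_j} ∑ s^{-k_j} ∏_{a≠j} m_a^{-k_a} = (-1)^{k_j} ζ(x₀^{k_j} (⧢_{a≠j} y_{k_a}))`
(`tendsto_omegaRoot_part`, `hasSum_mordellTornheim`). Thus `Ω(k)` is the sum over `j` of these
multiple zeta values.

*Symmetric side.* The sum defining `ζ_𝒮^⧢(k)` runs over the factorizations `x₁y_k = A x₁ B`, with
the reversed word of `A` and the word `B` as arguments of `ζ^⧢`. As `ζ^⧢` is multiplicative
(`linExt_zetaSh_shuffle`), it is `ζ^⧢` of an element of `𝔥¹` built with the operator `splitAtX1`.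
The identity `splitAtX1_shuffle`, the algebraic form of path composition for iterated integrals,
evaluates this operator at shuffle products. At `x₀^{k_r} (y_{k₁} ⧢ ⋯ ⧢ y_{k_{r-1}})` the result is,
up to the sign `(-1)^{k_r}`, exactly the value of `Ω(k)` found above (`sum_omegaTerm`): the
symmetric identity holds in `𝒵`, even before reduction modulo `ζ(2)`.

*Comparison.* Both kinds of omega values are thus values of `ζ_𝒜` and `ζ_𝒮` at the same elements of
`𝔥¹`, so equal kernels give isomorphic spans (`exists_equiv_map_of_ker_eq`).
-/

noncomputable section

namespace OmegaValue

/-! ### The shuffle algebra -/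

theorem shuffle_one_left (a : WordAlg) : shuffle 1 a = a := by
  suffices h : shuffle 1 = LinearMap.id from LinearMap.congr_fun h a
  refine wordBasis.ext fun w => ?_
  rw [wordBasis_apply, ← word_nil, shuffle_word, shuffleWord, LinearMap.id_apply]

theorem shuffle_one_right (a : WordAlg) : shuffle a 1 = a := by
  suffices h : shuffle.flip 1 = LinearMap.id from LinearMap.congr_fun h a
  refine wordBasis.ext fun w => ?_
  rw [wordBasis_apply, ← word_nil, LinearMap.flip_apply, shuffle_word, LinearMap.id_apply]
  cases w <;> rw [shuffleWord]

theorem shuffle_mul_mul (u v : Fin 2) (a b : WordAlg) :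
    shuffle (x u * a) (x v * b) = x u * shuffle a (x v * b) + x v * shuffle (x u * a) b := by
  suffices h : (shuffle ∘ₗ LinearMap.mulLeft ℚ (x u)).compl₂ (LinearMap.mulLeft ℚ (x v)) =
      (shuffle.compl₂ (LinearMap.mulLeft ℚ (x v))).compr₂ (LinearMap.mulLeft ℚ (x u)) +
      (shuffle ∘ₗ LinearMap.mulLeft ℚ (x u)).compr₂ (LinearMap.mulLeft ℚ (x v)) from
    LinearMap.congr_fun₂ h a b
  refine wordBasis.ext fun w => wordBasis.ext fun w' => ?_
  simp only [wordBasis_apply, LinearMap.compl₂_apply, LinearMap.comp_apply, LinearMap.add_apply,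
    LinearMap.compr₂_apply, LinearMap.mulLeft_apply]
  rw [← word_cons, ← word_cons, shuffle_word, shuffle_word, shuffle_word, shuffleWord]

theorem shuffle_comm (a b : WordAlg) : shuffle a b = shuffle b a := by
  suffices h : shuffle = shuffle.flip from LinearMap.congr_fun₂ h a b
  refine wordBasis.ext fun w => wordBasis.ext fun w' => ?_
  rw [wordBasis_apply, wordBasis_apply, LinearMap.flip_apply]
  induction hn : w.length + w'.length using Nat.strong_induction_on generalizing w w' with
  | _ n ih =>
    match w, w' with
    | [], w' => rw [word_nil, shuffle_one_left, shuffle_one_right]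
    | u :: w, [] => rw [word_nil, shuffle_one_left, shuffle_one_right]
    | u :: w, v :: w' =>
      simp only [List.length_cons] at hn
      have h1 := ih _ (by simp; omega) w (v :: w') rfl
      have h2 := ih _ (by simp; omega) (u :: w) w' rfl
      simp only [word_cons] at h1 h2 ⊢
      rw [shuffle_mul_mul, shuffle_mul_mul, h1, h2, add_comm]

theorem shuffle_assoc (a b c : WordAlg) :
    shuffle (shuffle a b) c = shuffle a (shuffle b c) := by
  suffices h : shuffle.compr₂ shuffle =
      (LinearMap.lcomp ℚ (WordAlg →ₗ[ℚ] WordAlg) shuffle ∘ₗ LinearMap.llcomp ℚ _ _ _) ∘ₗ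
        shuffle from
    LinearMap.congr_fun (LinearMap.congr_fun₂ h a b) c
  refine wordBasis.ext fun w => wordBasis.ext fun w' => wordBasis.ext fun w'' => ?_
  change shuffle (shuffle (wordBasis w) (wordBasis w')) (wordBasis w'') =
    shuffle (wordBasis w) (shuffle (wordBasis w') (wordBasis w''))
  rw [wordBasis_apply, wordBasis_apply, wordBasis_apply]
  induction hn : w.length + w'.length + w''.length using Nat.strong_induction_on
    generalizing w w' w'' with
  | _ n ih =>
    match w, w', w'' with
    | [], w', w'' => rw [word_nil, shuffle_one_left, shuffle_one_left]
    | u :: w, [], w'' => rw [word_nil, shuffle_one_left, shuffle_one_right]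
    | u :: w, v :: w', [] => rw [word_nil, shuffle_one_right, shuffle_one_right]
    | u :: w, v :: w', t :: w'' =>
      simp only [List.length_cons] at hn
      have h1 := ih _ (by simp; omega) w (v :: w') (t :: w'') rfl
      have h2 := ih _ (by simp; omega) (u :: w) w' (t :: w'') rfl
      have h3 := ih _ (by simp; omega) (u :: w) (v :: w') w'' rfl
      simp only [word_cons] at h1 h2 h3 ⊢
      rw [shuffle_mul_mul u v, map_add, LinearMap.add_apply] at h3
      rw [shuffle_mul_mul u v, map_add, LinearMap.add_apply, shuffle_mul_mul u t,
        shuffle_mul_mul v t, h1, h2, shuffle_mul_mul v t, map_add, map_add, shuffle_mul_mul u v,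
        shuffle_mul_mul u t, ← h3, mul_add, mul_add]
      abel

theorem shuffle_left_comm (a b c : WordAlg) :
    shuffle a (shuffle b c) = shuffle b (shuffle a c) := by
  rw [← shuffle_assoc, shuffle_comm a b, shuffle_assoc]

/-! ### Words ending in `x₁` -/

/-- `𝔥x₁`, the span of the words ending in `x₁`. -/
def rightX1 : Submodule ℚ WordAlg := LinearMap.range (LinearMap.mulRight ℚ (x 1))

theorem rightX1_le_H1 : rightX1 ≤ H1 := le_sup_right

theorem mul_mem_rightX1 (a : WordAlg) {b : WordAlg} (hb : b ∈ rightX1) : a * b ∈ rightX1 := by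
  obtain ⟨c, rfl⟩ := hb
  exact ⟨a * c, by simp [mul_assoc]⟩

theorem word_concat_eq_yIndex (w : List (Fin 2)) :
    ∃ (a : ℕ+) (k : Index), word w * x 1 = yIndex (a :: k) := by
  induction w with
  | nil => exact ⟨1, [], by simp [yIndex, y, word_nil]⟩
  | cons u w ih =>
    obtain ⟨a, k, h⟩ := ih
    match u with
    | 0 =>
      refine ⟨a + 1, k, ?_⟩
      rw [word_cons, mul_assoc, h]
      simp only [yIndex, List.map_cons, List.prod_cons, y, PNat.add_coe, PNat.one_coe,
        Nat.add_sub_cancel, ← mul_assoc]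
      rw [← pow_succ', Nat.sub_add_cancel a.pos]
    | 1 =>
      refine ⟨1, a :: k, ?_⟩
      rw [word_cons, mul_assoc, h]
      simp [yIndex, y]

theorem x0_mul_yIndex (a : ℕ+) (k : Index) : x 0 * yIndex (a :: k) = yIndex ((a + 1) :: k) := by
  simp only [yIndex, List.map_cons, List.prod_cons, y, PNat.add_coe, PNat.one_coe,
    Nat.add_sub_cancel, ← mul_assoc]
  rw [← pow_succ', Nat.sub_add_cancel a.pos]

theorem mem_span_of_mul {S : Submodule ℚ WordAlg} {f : WordAlg →ₗ[ℚ] WordAlg}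
    (h : ∀ w, f (word w) ∈ S) (a : WordAlg) : f a ∈ S := by
  have : LinearMap.range f ≤ S := by
    rw [LinearMap.range_eq_map, ← wordBasis.span_eq, Submodule.map_span_le]
    rintro _ ⟨w, rfl⟩
    rw [wordBasis_apply]
    exact h w
  exact this ⟨a, rfl⟩

theorem rightX1_le_span :
    rightX1 ≤ Submodule.span ℚ (Set.range fun p : ℕ+ × Index => yIndex (p.1 :: p.2)) := by
  rintro _ ⟨a, rfl⟩
  refine mem_span_of_mul (fun w => ?_) a
  obtain ⟨b, k, h⟩ := word_concat_eq_yIndex w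
  rw [LinearMap.mulRight_apply, h]
  exact Submodule.subset_span ⟨(b, k), rfl⟩

theorem H1_eq_span : H1 = Submodule.span ℚ (Set.range yIndex) := by
  apply le_antisymm
  · refine sup_le (Submodule.one_le.2 (Submodule.subset_span ⟨[], rfl⟩)) ?_
    refine rightX1_le_span.trans (Submodule.span_mono ?_)
    rintro _ ⟨p, rfl⟩
    exact ⟨_, rfl⟩
  · rw [Submodule.span_le]
    rintro _ ⟨k, rfl⟩
    exact yIndex_mem k

theorem H0_le_span : H0 ≤ Submodule.span ℚ (yIndex '' {k | Admissible k}) := by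
  refine sup_le (Submodule.one_le.2 (Submodule.subset_span ⟨[], trivial, rfl⟩)) ?_
  rintro _ ⟨a, rfl⟩
  refine mem_span_of_mul (fun w => ?_) a
  obtain ⟨b, k, h⟩ := word_concat_eq_yIndex w
  rw [LinearMap.comp_apply, LinearMap.mulRight_apply, LinearMap.mulLeft_apply, h, x0_mul_yIndex]
  refine Submodule.subset_span ⟨_, ?_, rfl⟩
  change 2 ≤ b + 1
  rw [← PNat.coe_le_coe]
  have := b.pos
  simp; omega

/-- Linear maps on `𝔥` that agree on the `y_k` agree on `𝔥¹`. -/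
theorem eqOn_H1 {M : Type*} [AddCommGroup M] [Module ℚ M] {f g : WordAlg →ₗ[ℚ] M}
    (h : ∀ k, f (yIndex k) = g (yIndex k)) {a : WordAlg} (ha : a ∈ H1) : f a = g a := by
  rw [H1_eq_span] at ha
  refine LinearMap.eqOn_span (s := Set.range yIndex) ?_ ha
  rintro _ ⟨k, rfl⟩
  exact h k

theorem x0_mul_mem_H0 {a : WordAlg} (ha : a ∈ rightX1) : x 0 * a ∈ H0 := by
  obtain ⟨b, rfl⟩ := ha
  exact mem_H0 b

theorem x0_pow_mul_mem_H0 (n : ℕ) (hn : n ≠ 0) {a : WordAlg} (ha : a ∈ rightX1) :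
    x 0 ^ n * a ∈ H0 := by
  obtain ⟨m, rfl⟩ := Nat.exists_eq_succ_of_ne_zero hn
  rw [pow_succ', mul_assoc]
  exact x0_mul_mem_H0 (mul_mem_rightX1 _ ha)

theorem shuffle_mem_rightX1 {a b : WordAlg} (ha : a ∈ rightX1) (hb : b ∈ rightX1) :
    shuffle a b ∈ rightX1 := by
  suffices h : ∀ w w', shuffle (word w * x 1) (word w' * x 1) ∈ rightX1 by
    obtain ⟨a, rfl⟩ := ha
    obtain ⟨b, rfl⟩ := hb
    refine mem_span_of_mul (f := shuffle.flip (LinearMap.mulRight ℚ (x 1) b) ∘ₗ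
      LinearMap.mulRight ℚ (x 1)) (fun w => ?_) a
    exact mem_span_of_mul (f := shuffle (LinearMap.mulRight ℚ (x 1) (word w)) ∘ₗ
      LinearMap.mulRight ℚ (x 1)) (fun w' => h w w') b
  intro w w'
  have hx (a : WordAlg) : a * x 1 ∈ rightX1 := ⟨a, rfl⟩
  have h1 : x 1 ∈ rightX1 := ⟨1, by simp⟩
  induction hn : w.length + w'.length using Nat.strong_induction_on generalizing w w' with
  | _ n ih =>
    match w, w' with
    | [], [] =>
      have := shuffle_mul_mul 1 1 1 1
      rw [word_nil, one_mul]
      rw [mul_one, shuffle_one_left, shuffle_one_right] at this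
      rw [this]
      exact add_mem (mul_mem_rightX1 _ h1) (mul_mem_rightX1 _ h1)
    | u :: w, [] =>
      have := shuffle_mul_mul u 1 (word w * x 1) 1
      rw [mul_one, shuffle_one_right] at this
      rw [word_nil, one_mul, word_cons, mul_assoc, this]
      refine add_mem (mul_mem_rightX1 _ ?_)
        (mul_mem_rightX1 _ (mul_mem_rightX1 _ (hx _)))
      have := ih _ (by simp only [List.length_cons] at hn; omega) w [] rfl
      simpa [word_nil] using this
    | [], u :: w =>
      have := shuffle_mul_mul 1 u 1 (word w * x 1)
      rw [mul_one, shuffle_one_left] at this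
      rw [word_nil, one_mul, word_cons, mul_assoc, this]
      refine add_mem (mul_mem_rightX1 _ (mul_mem_rightX1 _ (hx _))) (mul_mem_rightX1 _ ?_)
      have := ih _ (by simp only [List.length_cons] at hn; omega) [] w rfl
      simpa [word_nil] using this
    | u :: w, v :: w' =>
      simp only [List.length_cons] at hn
      have a1 := ih _ (by simp; omega) w (v :: w') rfl
      have a2 := ih _ (by simp; omega) (u :: w) w' rfl
      simp only [word_cons, mul_assoc] at a1 a2 ⊢
      rw [shuffle_mul_mul]
      exact add_mem (mul_mem_rightX1 _ a1) (mul_mem_rightX1 _ a2)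

theorem mem_H1_iff {a : WordAlg} : a ∈ H1 ↔ ∃ c : ℚ, ∃ b ∈ rightX1, a = c • 1 + b := by
  constructor
  · intro h
    obtain ⟨a, ha, b, hb, rfl⟩ := Submodule.mem_sup.1 h
    obtain ⟨c, rfl⟩ := Submodule.mem_one.1 ha
    exact ⟨c, b, hb, by rw [Algebra.algebraMap_eq_smul_one]⟩
  · rintro ⟨c, b, hb, rfl⟩
    exact add_mem (H1.smul_mem _ one_mem_H1) (rightX1_le_H1 hb)

theorem shuffle_mem_H1 {a b : WordAlg} (ha : a ∈ H1) (hb : b ∈ H1) : shuffle a b ∈ H1 := by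
  obtain ⟨c, a', ha', rfl⟩ := mem_H1_iff.1 ha
  obtain ⟨d, b', hb', rfl⟩ := mem_H1_iff.1 hb
  simp only [map_add, LinearMap.add_apply, map_smul, LinearMap.smul_apply, shuffle_one_left,
    shuffle_one_right, smul_add]
  exact add_mem (add_mem (H1.smul_mem _ (H1.smul_mem _ one_mem_H1))
    (H1.smul_mem _ (rightX1_le_H1 ha'))) (add_mem (H1.smul_mem _ (rightX1_le_H1 hb'))
    (rightX1_le_H1 (shuffle_mem_rightX1 ha' hb')))

theorem shuffle_mem_H0 {a b : WordAlg} (ha : a ∈ H0) (hb : b ∈ H0) : shuffle a b ∈ H0 := by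
  refine H0_induction (P := fun a => shuffle a b ∈ H0) ?_ (fun w => ?_) (fun _ _ h h' => ?_)
    (fun c _ h => ?_) ha
  · rwa [shuffle_one_left]
  · refine H0_induction (P := fun b => shuffle (x 0 * (w * x 1)) b ∈ H0) ?_ (fun w' => ?_)
      (fun _ _ h h' => ?_) (fun c _ h => ?_) hb
    · rw [shuffle_one_right]
      exact mem_H0 w
    · rw [shuffle_mul_mul]
      exact add_mem (x0_mul_mem_H0 (shuffle_mem_rightX1 ⟨w, rfl⟩ (mul_mem_rightX1 _ ⟨w', rfl⟩)))
        (x0_mul_mem_H0 (shuffle_mem_rightX1 (mul_mem_rightX1 _ ⟨w, rfl⟩) ⟨w', rfl⟩))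
    · rw [map_add]
      exact add_mem h h'
    · rw [map_smul]
      exact H0.smul_mem _ h
  · rw [map_add]
    exact add_mem h h'
  · rw [map_smul]
    exact H0.smul_mem _ h

theorem shuffleList_nil : shuffleList [] = 1 := rfl

theorem shuffleList_cons (a : WordAlg) (L : List WordAlg) :
    shuffleList (a :: L) = shuffle a (shuffleList L) := rfl

theorem shuffleList_mem_H1 {L : List WordAlg} (h : ∀ a ∈ L, a ∈ H1) : shuffleList L ∈ H1 := by
  induction L with
  | nil => exact one_mem_H1
  | cons a L ih =>
    exact shuffle_mem_H1 (h a (by simp)) (ih fun b hb => h b (by simp [hb]))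

theorem y_mem_rightX1 (a : ℕ+) : y a ∈ rightX1 := ⟨_, rfl⟩

theorem shuffleList_y_mem_H1 (k : Index) : shuffleList (k.map y) ∈ H1 :=
  shuffleList_mem_H1 fun a ha => by
    obtain ⟨b, -, rfl⟩ := List.mem_map.1 ha
    exact rightX1_le_H1 (y_mem_rightX1 b)

theorem shuffleList_y_mem_rightX1 {k : Index} (hk : k ≠ []) :
    shuffleList (k.map y) ∈ rightX1 := by
  induction k with
  | nil => simp at hk
  | cons a k ih =>
    rw [List.map_cons, shuffleList_cons]
    cases k with
    | nil =>
      rw [List.map_nil, shuffleList_nil, shuffle_one_right]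
      exact y_mem_rightX1 a
    | cons b k => exact shuffle_mem_rightX1 (y_mem_rightX1 a) (ih (by simp))

theorem shuffleList_perm {L L' : List WordAlg} (h : L.Perm L') :
    shuffleList L = shuffleList L' := by
  induction h with
  | nil => rfl
  | cons a _ ih => rw [shuffleList_cons, shuffleList_cons, ih]
  | swap a b L => simp only [shuffleList_cons]; exact shuffle_left_comm _ _ _
  | trans _ _ h h' => exact h.trans h'

/-! ### Polylogarithms as formal power series -/

/-- The power series `∑_{m₁ > ⋯ > m_r > 0} t^{m₁} / (m₁^{k₁} ⋯ m_r^{k_r})` attached to the word of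
`y_k`. A leading `x₀` stands for `∫ dt / t` and a leading `x₁` for `∫ dt / (1 - t)`; integration of
`dt / t` ignores the constant coefficient, so the value at words ending in `x₀` is immaterial. -/
def polylogWord : List (Fin 2) → PowerSeries ℚ
  | [] => 1
  | u :: w => if u = 0 then PowerSeries.mk fun n => (n : ℚ)⁻¹ * PowerSeries.coeff n (polylogWord w)
    else PowerSeries.mk fun n =>
      (n : ℚ)⁻¹ * ∑ m ∈ Finset.range n, PowerSeries.coeff m (polylogWord w)

/-- The linear extension of `polylogWord` to `𝔥`. -/
def polylog : WordAlg →ₗ[ℚ] PowerSeries ℚ := wordBasis.constr ℚ polylogWord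

theorem polylog_word (w : List (Fin 2)) : polylog (word w) = polylogWord w := by
  rw [← wordBasis_apply, polylog, Module.Basis.constr_basis]

theorem polylog_one : polylog 1 = 1 := by rw [← word_nil, polylog_word, polylogWord]

theorem coeff_polylog_x0_mul (a : WordAlg) (n : ℕ) :
    PowerSeries.coeff n (polylog (x 0 * a)) = (n : ℚ)⁻¹ * PowerSeries.coeff n (polylog a) := by
  suffices h : PowerSeries.coeff n ∘ₗ polylog ∘ₗ LinearMap.mulLeft ℚ (x 0) =
      (n : ℚ)⁻¹ • (PowerSeries.coeff n ∘ₗ polylog) from LinearMap.congr_fun h a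
  refine wordBasis.ext fun w => ?_
  simp only [LinearMap.comp_apply, LinearMap.smul_apply, wordBasis_apply, LinearMap.mulLeft_apply,
    ← word_cons, polylog_word, polylogWord]
  simp

theorem coeff_polylog_x1_mul (a : WordAlg) (n : ℕ) :
    PowerSeries.coeff n (polylog (x 1 * a)) =
      (n : ℚ)⁻¹ * ∑ m ∈ Finset.range n, PowerSeries.coeff m (polylog a) := by
  suffices h : PowerSeries.coeff n ∘ₗ polylog ∘ₗ LinearMap.mulLeft ℚ (x 1) =
      (n : ℚ)⁻¹ • ∑ m ∈ Finset.range n, (PowerSeries.coeff m ∘ₗ polylog) by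
    simpa using LinearMap.congr_fun h a
  refine wordBasis.ext fun w => ?_
  simp only [LinearMap.comp_apply, LinearMap.smul_apply, wordBasis_apply, LinearMap.mulLeft_apply,
    ← word_cons, polylog_word, polylogWord, LinearMap.sum_apply]
  simp

theorem coeff_polylog_x0_pow_mul (j : ℕ) (a : WordAlg) (n : ℕ) :
    PowerSeries.coeff n (polylog (x 0 ^ j * a)) =
      ((n : ℚ) ^ j)⁻¹ * PowerSeries.coeff n (polylog a) := by
  induction j with
  | zero => simp
  | succ j ih => rw [pow_succ', mul_assoc, coeff_polylog_x0_mul, ih]; ring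

theorem constantCoeff_polylog_mul (u : Fin 2) (a : WordAlg) :
    PowerSeries.constantCoeff (polylog (x u * a)) = 0 := by
  rw [← PowerSeries.coeff_zero_eq_constantCoeff_apply]
  match u with
  | 0 => simp [coeff_polylog_x0_mul]
  | 1 => simp [coeff_polylog_x1_mul]

theorem constantCoeff_polylog_rightX1 {a : WordAlg} (ha : a ∈ rightX1) :
    PowerSeries.constantCoeff (polylog a) = 0 := by
  suffices h : (PowerSeries.coeff 0 ∘ₗ polylog) ∘ₗ LinearMap.mulRight ℚ (x 1) = 0 by
    obtain ⟨b, rfl⟩ := ha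
    simpa using LinearMap.congr_fun h b
  refine wordBasis.ext fun w => ?_
  rw [LinearMap.comp_apply, wordBasis_apply, LinearMap.mulRight_apply, LinearMap.comp_apply,
    PowerSeries.coeff_zero_eq_constantCoeff_apply, LinearMap.zero_apply]
  cases w with
  | nil => simpa [word_nil] using constantCoeff_polylog_mul 1 1
  | cons u w => rw [word_cons, mul_assoc, constantCoeff_polylog_mul]

open PowerSeries in
/-- The differential equations of the polylogarithms, multiplied by `t(1 - t)` so that both letters
are treated at once. -/
theorem derivative_polylog_mul (u : Fin 2) {a : WordAlg} (ha : u = 0 → a ∈ rightX1) :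
    (1 - X) * (X * derivative ℚ (polylog (x u * a))) =
      (if u = 0 then 1 - X else X) * polylog a := by
  have hX (f : PowerSeries ℚ) (n : ℕ) : coeff n (X * derivative ℚ f) = n * coeff n f := by
    cases n with
    | zero => simp
    | succ n => rw [coeff_succ_X_mul, coeff_derivative]; push_cast; ring
  match u with
  | 0 =>
    rw [if_pos rfl]
    congr 1
    ext n
    rw [hX, coeff_polylog_x0_mul]
    rcases Nat.eq_zero_or_pos n with rfl | hn
    · have := constantCoeff_polylog_rightX1 (ha rfl)
      rw [← coeff_zero_eq_constantCoeff_apply] at this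
      simp [this]
    · rw [← mul_assoc, mul_inv_cancel₀ (by positivity), one_mul]
  | 1 =>
    rw [if_neg (by decide)]
    ext n
    rw [sub_mul, one_mul, map_sub, hX, coeff_polylog_x1_mul]
    cases n with
    | zero => simp
    | succ n =>
      rw [coeff_succ_X_mul, coeff_succ_X_mul, hX, coeff_polylog_x1_mul, Finset.sum_range_succ,
        ← mul_assoc, mul_inv_cancel₀ (by positivity), one_mul]
      rcases Nat.eq_zero_or_pos n with rfl | hn
      · simp
      · rw [← mul_assoc, mul_inv_cancel₀ (by positivity), one_mul, add_sub_cancel_left]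

theorem word_mem_rightX1 {w : List (Fin 2)} (h : w.getLast? = some 1) : word w ∈ rightX1 := by
  obtain ⟨v, rfl⟩ := List.getLast?_eq_some_iff.1 h
  exact ⟨word v, by rw [word_append, word_singleton]; rfl⟩

open PowerSeries in
/-- Both sides satisfy the same differential equation, with the same initial value `0`. -/
theorem polylog_shuffle_word (w w' : List (Fin 2)) (hw : w = [] ∨ w.getLast? = some 1)
    (hw' : w' = [] ∨ w'.getLast? = some 1) :
    polylog (shuffle (word w) (word w')) = polylog (word w) * polylog (word w') := by
  induction hn : w.length + w'.length using Nat.strong_induction_on generalizing w w' with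
  | _ n ih =>
    match w, w' with
    | [], w' => rw [word_nil, shuffle_one_left, polylog_one, one_mul]
    | u :: w, [] => rw [word_nil, shuffle_one_right, polylog_one, mul_one]
    | u :: w, v :: w' =>
      simp only [List.length_cons] at hn
      have tail {u : Fin 2} {w : List (Fin 2)} (h : u :: w = [] ∨ (u :: w).getLast? = some 1) :
          (w = [] ∨ w.getLast? = some 1) ∧ (u = 0 → word w ∈ rightX1) := by
        cases w with
        | nil => simp at h; simp [h]
        | cons t w => simp at h; exact ⟨Or.inr (by simpa using h), fun _ =>
            word_mem_rightX1 (by simpa using h)⟩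
      obtain ⟨h1, h2⟩ := tail hw
      obtain ⟨h3, h4⟩ := tail hw'
      have a1 := ih _ (by simp; omega) w (v :: w') h1 hw' rfl
      have a2 := ih _ (by simp; omega) (u :: w) w' hw h3 rfl
      have m1 := word_mem_rightX1 (hw.resolve_left (by simp))
      have m2 := word_mem_rightX1 (hw'.resolve_left (by simp))
      have d1 := derivative_polylog_mul u h2
      have d2 := derivative_polylog_mul v h4
      simp only [word_cons] at a1 a2 m1 m2 ⊢
      have d3 := derivative_polylog_mul u fun hu => shuffle_mem_rightX1 (h2 hu) m2
      have d4 := derivative_polylog_mul v fun hv => shuffle_mem_rightX1 m1 (h4 hv)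
      rw [shuffle_mul_mul, map_add]
      have hne : (1 - X : PowerSeries ℚ) ≠ 0 := fun h => by
        simpa using congrArg constantCoeff h
      refine derivative.ext (mul_left_cancel₀ X_ne_zero (mul_left_cancel₀ hne ?_)) ?_
      · rw [map_add, Derivation.leibniz, smul_eq_mul, smul_eq_mul]
        rw [a1] at d3
        rw [a2] at d4
        linear_combination d3 + d4 - polylog (x v * word w') * d1 - polylog (x u * word w) * d2
      · simp [constantCoeff_polylog_mul]

theorem getLast?_yWord (k : Index) : yWord k = [] ∨ (yWord k).getLast? = some 1 := by
  rcases List.eq_nil_or_concat k with rfl | ⟨k, a, rfl⟩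
  · exact Or.inl rfl
  · right
    simp [yWord]

/-- Polylogarithms multiply by the shuffle product. -/
theorem polylog_shuffle {a b : WordAlg} (ha : a ∈ H1) (hb : b ∈ H1) :
    polylog (shuffle a b) = polylog a * polylog b := by
  refine eqOn_H1 (f := polylog ∘ₗ shuffle.flip b) (g := LinearMap.mulRight ℚ (polylog b) ∘ₗ polylog)
    (fun k => ?_) ha
  refine eqOn_H1 (f := polylog ∘ₗ shuffle (yIndex k))
    (g := LinearMap.mulLeft ℚ (polylog (yIndex k)) ∘ₗ polylog) (fun l => ?_) hb
  rw [LinearMap.comp_apply, LinearMap.comp_apply, LinearMap.mulLeft_apply, yIndex_eq_word,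
    yIndex_eq_word]
  exact polylog_shuffle_word _ _ (getLast?_yWord k) (getLast?_yWord l)

theorem yIndex_nil : yIndex [] = 1 := rfl

theorem yIndex_cons (a : ℕ+) (k : Index) : yIndex (a :: k) = y a * yIndex k := rfl

theorem coeff_polylog_y_mul (a : ℕ+) (b : WordAlg) (n : ℕ) :
    PowerSeries.coeff n (polylog (y a * b)) =
      ((n : ℚ) ^ (a : ℕ))⁻¹ * ∑ m ∈ Finset.range n, PowerSeries.coeff m (polylog b) := by
  rw [y, mul_assoc, coeff_polylog_x0_pow_mul, coeff_polylog_x1_mul, ← mul_assoc, ← mul_inv,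
    ← pow_succ, Nat.sub_add_cancel a.pos]

theorem harmonicSum_eq_sum_coeff (k : Index) (n : ℕ) (hn : 0 < n) :
    harmonicSum ℚ k n = ∑ m ∈ Finset.range n, PowerSeries.coeff m (polylog (yIndex k)) := by
  induction k generalizing n with
  | nil =>
    rw [harmonicSum, yIndex_nil, polylog_one, Finset.sum_eq_single 0]
    · simp
    · intro m _ hm
      rw [PowerSeries.coeff_one, if_neg hm]
    · simp [hn]
  | cons a k ih =>
    rw [harmonicSum, Finset.range_eq_Ico, Finset.sum_eq_sum_Ico_succ_bot hn, yIndex_cons,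
      coeff_polylog_y_mul]
    simp only [Finset.range_zero, Finset.sum_empty, mul_zero, zero_add]
    refine Finset.sum_congr rfl fun m hm => ?_
    rw [coeff_polylog_y_mul, ih m (Finset.mem_Ico.1 hm).1]

theorem coeff_polylog_yIndex_cons (a : ℕ+) (k : Index) (n : ℕ) :
    PowerSeries.coeff n (polylog (yIndex (a :: k))) =
      ((n : ℚ) ^ (a : ℕ))⁻¹ * harmonicSum ℚ k n := by
  rw [yIndex_cons, coeff_polylog_y_mul]
  rcases Nat.eq_zero_or_pos n with rfl | hn
  · simp
  · rw [harmonicSum_eq_sum_coeff k n hn]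

theorem coeff_polylog_y (a : ℕ+) (n : ℕ) :
    PowerSeries.coeff n (polylog (y a)) = ((n : ℚ) ^ (a : ℕ))⁻¹ := by
  have := coeff_polylog_yIndex_cons a [] n
  simpa [yIndex, harmonicSum] using this

theorem polylog_shuffleList (k : Index) :
    polylog (shuffleList (k.map y)) = ∏ i : Fin k.length, polylog (y (k.get i)) := by
  have : polylog (shuffleList (k.map y)) = (k.map fun a => polylog (y a)).prod := by
    induction k with
    | nil => simp [shuffleList_nil, polylog_one]
    | cons a k ih =>
      rw [List.map_cons, shuffleList_cons, polylog_shuffle (rightX1_le_H1 (y_mem_rightX1 a))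
        (shuffleList_y_mem_H1 k), ih, List.map_cons, List.prod_cons]
  rw [this, ← Fin.prod_univ_fun_getElem]
  rfl

theorem mem_positiveTuples {r n : ℕ} {m : Fin r → ℕ} :
    m ∈ positiveTuples r n ↔ ∑ a, m a = n ∧ ∀ a, 0 < m a := by
  simp [positiveTuples]

/-- The sum `ω_n(k)` is a coefficient of the product of the `Li_{k_a}(t)`. -/
theorem coeff_polylog_shuffleList (k : Index) (n : ℕ) :
    PowerSeries.coeff n (polylog (shuffleList (k.map y))) = omegaN n k := by
  rw [polylog_shuffleList, PowerSeries.coeff_prod, omegaN, positiveTuples, Finset.sum_filter]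
  refine Finset.sum_nbij' (fun f => f) (fun f => Finsupp.equivFunOnFinite.symm f) ?_ ?_ ?_ ?_ ?_
  · intro f hf
    rw [Finset.mem_finsuppAntidiag] at hf
    simp only [Finset.mem_piAntidiag, Finset.mem_univ, implies_true, and_true]
    exact hf.1
  · intro f hf
    simp only [Finset.mem_piAntidiag, Finset.mem_univ, implies_true, and_true] at hf
    rw [Finset.mem_finsuppAntidiag]
    exact ⟨hf, Finset.subset_univ _⟩
  · intro f _
    ext
    simp
  · intro f _
    ext
    simp
  · intro f _
    simp only [coeff_polylog_y, one_div]
    split_ifs with h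
    · rfl
    · push Not at h
      obtain ⟨a, ha⟩ := h
      refine Finset.prod_eq_zero (Finset.mem_univ a) ?_
      simp [Nat.le_zero.1 ha]

/-- Summing the coefficients of index below `n` turns polylogarithms into multiple harmonic sums
`H_n`. -/
theorem linExt_harmonicSum {a : WordAlg} (ha : a ∈ H1) (n : ℕ) (hn : 0 < n) :
    linExt (fun k => harmonicSum ℚ k n) a =
      ∑ m ∈ Finset.range n, PowerSeries.coeff m (polylog a) := by
  have := eqOn_H1 (f := linExt (fun k => harmonicSum ℚ k n))
    (g := ∑ m ∈ Finset.range n, PowerSeries.coeff m ∘ₗ polylog) (fun k => ?_) ha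
  · simpa using this
  · rw [linExt_yIndex, harmonicSum_eq_sum_coeff k n hn]
    simp

/-! ### Tuples with a given sum -/

/-- A tuple of `r + 1` positive integers with sum `N` is determined by the other `r` entries once
the `j`-th is left out. -/
theorem sum_positiveTuples_succ {M : Type*} [AddCommMonoid M] {r : ℕ}
    (j : Fin (r + 1)) (N : ℕ) (F : (Fin (r + 1) → ℕ) → M) :
    ∑ m ∈ positiveTuples (r + 1) N, F m =
      ∑ n ∈ Finset.range N, ∑ m ∈ positiveTuples r n, F (j.insertNth (N - n) m) := by
  rw [Finset.sum_sigma']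
  refine Finset.sum_nbij' (fun m => ⟨∑ i, m (j.succAbove i), fun i => m (j.succAbove i)⟩)
    (fun s => j.insertNth (N - s.1) s.2) ?_ ?_ ?_ ?_ ?_
  · intro m hm
    obtain ⟨h1, h2⟩ := mem_positiveTuples.1 hm
    rw [Fin.sum_univ_succAbove _ j] at h1
    have := h2 j
    simp only [Finset.mem_sigma, Finset.mem_range, mem_positiveTuples, true_and]
    exact ⟨by omega, fun i => h2 _⟩
  · rintro ⟨n, m⟩ hm
    simp only [Finset.mem_sigma, Finset.mem_range, mem_positiveTuples] at hm
    obtain ⟨h1, h2, h3⟩ := hm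
    rw [mem_positiveTuples, Fin.sum_univ_succAbove _ j, Fin.forall_iff_succAbove j]
    simp only [Fin.insertNth_apply_same, Fin.insertNth_apply_succAbove]
    exact ⟨by omega, by omega, h3⟩
  · intro m hm
    obtain ⟨h1, h2⟩ := mem_positiveTuples.1 hm
    rw [Fin.sum_univ_succAbove _ j] at h1
    funext a
    refine Fin.succAboveCases j ?_ (fun i => ?_) a
    · simp only [Fin.insertNth_apply_same]
      omega
    · simp only [Fin.insertNth_apply_succAbove]
  · rintro ⟨n, m⟩ hm
    simp only [Finset.mem_sigma, Finset.mem_range, mem_positiveTuples] at hm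
    simp [hm.2.1]
  · intro m hm
    obtain ⟨h1, h2⟩ := mem_positiveTuples.1 hm
    rw [Fin.sum_univ_succAbove _ j] at h1
    congr 1
    funext a
    refine Fin.succAboveCases j ?_ (fun i => ?_) a
    · simp only [Fin.insertNth_apply_same]
      omega
    · simp only [Fin.insertNth_apply_succAbove]

theorem lt_of_mem_positiveTuples {r n : ℕ} {m : Fin r → ℕ} (hm : m ∈ positiveTuples r n)
    (hr : 2 ≤ r) (a : Fin r) : m a < n := by
  obtain ⟨h1, h2⟩ := mem_positiveTuples.1 hm
  obtain ⟨b, hb⟩ : ∃ b : Fin r, b ≠ a := by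
    have : Nontrivial (Fin r) := Fin.nontrivial_iff_two_le.2 hr
    exact exists_ne a
  have : m a + m b ≤ ∑ a, m a := by
    rw [← Finset.sum_pair hb.symm]
    exact Finset.sum_le_sum_of_subset (Finset.subset_univ _)
  have := h2 b
  omega

theorem le_of_mem_positiveTuples {r n : ℕ} {m : Fin r → ℕ} (hm : m ∈ positiveTuples r n)
    (a : Fin r) : m a ≤ n := by
  rw [← (mem_positiveTuples.1 hm).1]
  exact Finset.single_le_sum (f := m) (fun _ _ => Nat.zero_le _) (Finset.mem_univ a)

theorem omegaN_of_length {k : Index} {r : ℕ} (h : r = k.length) (n : ℕ) :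
    omegaN n k = ∑ m ∈ positiveTuples r n, ∏ a, 1 / (m a : ℚ) ^ (k.get (a.cast h) : ℕ) := by
  subst h
  rfl

theorem length_eraseIdx_of_succ {k : Index} {r : ℕ} (h : r + 1 = k.length) (j : Fin (r + 1)) :
    r = (k.eraseIdx j).length := by
  have := j.2
  rw [List.length_eraseIdx_of_lt (by omega)]
  omega

theorem get_succAbove {k : Index} {r : ℕ} (h : r + 1 = k.length) (j : Fin (r + 1)) (i : Fin r) :
    k.get ((j.succAbove i).cast h) =
      (k.eraseIdx j).get (i.cast (length_eraseIdx_of_succ h j)) := by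
  simp only [List.get_eq_getElem, Fin.val_cast, List.getElem_eraseIdx, Fin.succAbove, Fin.lt_def,
    Fin.val_castSucc]
  split_ifs <;> simp

/-! ### Reduction of rational numbers modulo `p` -/

/-- The rational number `a` is `p`-integral and reduces to `b` modulo `p`. -/
def ReducesTo (p : ℕ) [Fact p.Prime] (a : ℚ) (b : ZMod p) : Prop :=
  (a.den : ZMod p) ≠ 0 ∧ (a : ZMod p) = b

section ReducesTo

variable {p : ℕ} [Fact p.Prime]

theorem den_ne_zero_of_dvd {a b : ℕ} (h : a ∣ b) (hb : (b : ZMod p) ≠ 0) : (a : ZMod p) ≠ 0 := by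
  obtain ⟨c, rfl⟩ := h
  intro h0
  exact hb (by rw [Nat.cast_mul, h0, zero_mul])

theorem ReducesTo.add {a a' : ℚ} {b b' : ZMod p} (h : ReducesTo p a b) (h' : ReducesTo p a' b') :
    ReducesTo p (a + a') (b + b') :=
  ⟨den_ne_zero_of_dvd (Rat.add_den_dvd _ _) (by rw [Nat.cast_mul]; exact mul_ne_zero h.1 h'.1),
    by rw [Rat.cast_add_of_ne_zero h.1 h'.1, h.2, h'.2]⟩

theorem ReducesTo.mul {a a' : ℚ} {b b' : ZMod p} (h : ReducesTo p a b) (h' : ReducesTo p a' b') :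
    ReducesTo p (a * a') (b * b') :=
  ⟨den_ne_zero_of_dvd (Rat.mul_den_dvd _ _) (by rw [Nat.cast_mul]; exact mul_ne_zero h.1 h'.1),
    by rw [Rat.cast_mul_of_ne_zero h.1 h'.1, h.2, h'.2]⟩

theorem reducesTo_zero : ReducesTo p 0 0 := by simp [ReducesTo]

theorem reducesTo_one : ReducesTo p 1 1 := by simp [ReducesTo]

theorem reducesTo_sum {ι : Type*} {s : Finset ι} {f : ι → ℚ} {g : ι → ZMod p}
    (h : ∀ i ∈ s, ReducesTo p (f i) (g i)) : ReducesTo p (∑ i ∈ s, f i) (∑ i ∈ s, g i) := by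
  classical
  induction s using Finset.induction_on with
  | empty => simpa using reducesTo_zero
  | insert i s hi ih =>
    rw [Finset.sum_insert hi, Finset.sum_insert hi]
    exact (h i (by simp)).add (ih fun j hj => h j (by simp [hj]))

theorem reducesTo_prod {ι : Type*} {s : Finset ι} {f : ι → ℚ} {g : ι → ZMod p}
    (h : ∀ i ∈ s, ReducesTo p (f i) (g i)) : ReducesTo p (∏ i ∈ s, f i) (∏ i ∈ s, g i) := by
  classical
  induction s using Finset.induction_on with
  | empty => simpa using reducesTo_one
  | insert i s hi ih =>
    rw [Finset.prod_insert hi, Finset.prod_insert hi]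
    exact (h i (by simp)).mul (ih fun j hj => h j (by simp [hj]))

theorem reducesTo_inv_pow {n : ℕ} (hn : n < p) (l : ℕ) :
    ReducesTo p ((n : ℚ) ^ l)⁻¹ ((n : ZMod p) ^ l)⁻¹ := by
  rcases Nat.eq_zero_or_pos n with rfl | hpos
  · rcases Nat.eq_zero_or_pos l with rfl | hl
    · simpa using reducesTo_one
    · simpa [hl.ne'] using reducesTo_zero
  have hn0 : ((n ^ l : ℕ) : ZMod p) ≠ 0 := by
    rw [Nat.cast_pow]
    refine pow_ne_zero _ fun h => ?_
    have := Nat.le_of_dvd hpos ((ZMod.natCast_eq_zero_iff n p).1 h)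
    omega
  refine ⟨?_, ?_⟩
  · have := Rat.inv_natCast_den_of_pos (a := n ^ l) (by positivity)
    rw [← Nat.cast_pow, this]
    exact hn0
  · have h7 := Rat.cast_inv_of_ne_zero (α := ZMod p) (q := ((n ^ l : ℕ) : ℚ)) (by simpa using hn0)
    simpa using h7

theorem reducesTo_omegaN {k : Index} {r n : ℕ} (h : r = k.length)
    (hlt : ∀ m ∈ positiveTuples r n, ∀ a, m a < p) :
    ReducesTo p (omegaN n k)
      (∑ m ∈ positiveTuples r n, ∏ a, ((m a : ZMod p) ^ (k.get (a.cast h) : ℕ))⁻¹) := by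
  rw [omegaN_of_length h]
  refine reducesTo_sum fun m hm => reducesTo_prod fun a _ => ?_
  rw [one_div]
  exact reducesTo_inv_pow (hlt m hm a) _

/-- As `m_j = p - n` with `n` the sum of the other entries, `m_j ≡ -n` modulo `p`. -/
theorem cast_omegaN_eq {k : Index} (hk : 2 ≤ k.length) (j : Fin k.length) :
    (omegaN p k : ZMod p) = (-1) ^ (k.get j : ℕ) *
      ((∑ n ∈ Finset.range p, ((n : ℚ) ^ (k.get j : ℕ))⁻¹ * omegaN n (k.eraseIdx j) : ℚ) :
        ZMod p) := by
  obtain ⟨r, h⟩ : ∃ r, r + 1 = k.length := ⟨k.length - 1, by omega⟩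
  obtain ⟨j, rfl⟩ : ∃ i : Fin (r + 1), j = i.cast h := ⟨j.cast h.symm, by simp⟩
  rw [(reducesTo_omegaN h fun m hm a => lt_of_mem_positiveTuples hm (by omega) a).2,
    Fin.val_cast, (reducesTo_sum fun n hn => (reducesTo_inv_pow (Finset.mem_range.1 hn) _).mul
      (reducesTo_omegaN (length_eraseIdx_of_succ h j) fun m hm a =>
        (le_of_mem_positiveTuples hm a).trans_lt (Finset.mem_range.1 hn))).2,
    sum_positiveTuples_succ j, Finset.mul_sum]
  refine Finset.sum_congr rfl fun n hn => ?_
  rw [← mul_assoc, Finset.mul_sum]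
  refine Finset.sum_congr rfl fun m _ => ?_
  rw [Fin.prod_univ_succAbove _ j]
  simp only [Fin.insertNth_apply_same, Fin.insertNth_apply_succAbove, get_succAbove h j]
  congr 1
  rw [Nat.cast_sub (Finset.mem_range.1 hn).le, ZMod.natCast_self, zero_sub, neg_pow, mul_inv,
    ← inv_pow, inv_neg, inv_one]

end ReducesTo

/-! ### Finite multiple omega values -/

/-- Linear combinations of the `ζ_𝒜(k)` are represented by the reductions of the same linear
combinations of the rational numbers `H_p(k)`, which are `p`-integral for almost all `p`. -/
theorem linExt_zetaA (a : WordAlg) :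
    {p : Nat.Primes | ((linExt (fun k => harmonicSum ℚ k p) a).den : ZMod p) = 0}.Finite ∧
      linExt zetaA a =
        RingA.mk fun p => ((linExt (fun k => harmonicSum ℚ k p) a : ℚ) : ZMod p) := by
  have ha : a ∈ Submodule.span ℚ (Set.range wordBasis) := by
    rw [wordBasis.span_eq]
    trivial
  have hsmul (c : ℚ) (b : RingA) : c • b = ratToA c * b := Algebra.smul_def c b
  have hrat (c : ℚ) : ratToA c = RingA.mk fun p => (c : ZMod p) := rfl
  induction ha using Submodule.span_induction with
  | mem a h =>
    obtain ⟨w, rfl⟩ := h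
    simp only [linExt, Module.Basis.constr_basis]
    by_cases hw : ∃ k, yWord k = w
    · obtain ⟨k, rfl⟩ := hw
      simp only [yWord_injective.extend_apply]
      refine ⟨Set.Finite.subset Set.finite_empty fun p hp => ?_, rfl⟩
      exact (cast_harmonicSum p k p le_rfl).1 hp
    · simp only [Function.extend_apply' _ _ _ hw, Pi.zero_apply]
      simp only [Rat.den_zero, Nat.cast_one, one_ne_zero, Set.ofPred_false, Rat.cast_zero]
      exact ⟨Set.finite_empty, (map_zero RingA.mk).symm⟩
  | zero =>
    simp only [map_zero, Rat.den_zero, Nat.cast_one, one_ne_zero, Rat.cast_zero]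
    exact ⟨by simp, (map_zero RingA.mk).symm⟩
  | add a b _ _ ha hb =>
    have key : ∀ p : Nat.Primes,
        ¬ (((linExt (fun k => harmonicSum ℚ k p) a).den : ZMod p) = 0 ∨
          ((linExt (fun k => harmonicSum ℚ k p) b).den : ZMod p) = 0) →
        ReducesTo p (linExt (fun k => harmonicSum ℚ k p) (a + b))
          ((linExt (fun k => harmonicSum ℚ k p) a : ℚ) +
            (linExt (fun k => harmonicSum ℚ k p) b : ℚ)) := by
      intro p hp
      rw [not_or] at hp
      rw [map_add]
      exact ReducesTo.add ⟨hp.1, rfl⟩ ⟨hp.2, rfl⟩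
    refine ⟨(ha.1.union hb.1).subset fun p hp => ?_, ?_⟩
    · by_contra h
      exact (key p h).1 hp
    · rw [map_add, ha.2, hb.2, ← map_add]
      refine (RingA.mk_eq_of_finite ((ha.1.union hb.1).subset fun p hp => ?_))
      by_contra h
      exact hp (key p h).2.symm
  | smul c a _ ha =>
    have key : ∀ p : Nat.Primes,
        ¬ ((c.den : ZMod p) = 0 ∨
          ((linExt (fun k => harmonicSum ℚ k p) a).den : ZMod p) = 0) →
        ReducesTo p (linExt (fun k => harmonicSum ℚ k p) (c • a))
          (c * (linExt (fun k => harmonicSum ℚ k p) a : ℚ)) := by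
      intro p hp
      rw [not_or] at hp
      rw [map_smul, smul_eq_mul]
      exact ReducesTo.mul ⟨hp.1, rfl⟩ ⟨hp.2, rfl⟩
    have hfin := (finite_primes_dvd c.den_nz).union ha.1
    refine ⟨hfin.subset fun p hp => ?_, ?_⟩
    · by_contra h
      exact (key p h).1 hp
    · rw [map_smul, ha.2, hsmul, hrat, ← map_mul]
      refine (RingA.mk_eq_of_finite (hfin.subset fun p hp => ?_))
      by_contra h
      exact hp (key p h).2.symm

theorem omegaWord_mem_H1 (k : Index) (hk : k ≠ []) (h2 : 2 ≤ k.length) :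
    omegaWord k hk ∈ H1 := by
  refine rightX1_le_H1 (mul_mem_rightX1 _ (shuffleList_y_mem_rightX1 fun h => ?_))
  have := congrArg List.length h
  simp at this
  omega

theorem omegaA_eq (k : Index) (hk : k ≠ []) (h2 : 2 ≤ k.length) :
    omegaA k = (-1) ^ (k.getLast hk : ℕ) * linExt zetaA (omegaWord k hk) := by
  rw [(linExt_zetaA _).2, omegaA, ← map_one RingA.mk, ← map_neg, ← map_pow, ← map_mul]
  congr 1
  funext p
  have h := cast_omegaN_eq (p := p) h2 ⟨k.length - 1, by omega⟩
  rw [Pi.mul_apply, Pi.pow_apply, Pi.neg_apply, Pi.one_apply, h,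
    linExt_harmonicSum (omegaWord_mem_H1 k hk h2) p p.2.pos]
  simp only [omegaWord, coeff_polylog_x0_pow_mul, coeff_polylog_shuffleList,
    List.getLast_eq_getElem, List.get_eq_getElem, List.eraseIdx_length_sub_one]

/-! ### Multiple zeta values and the shuffle product -/

theorem hasSum_zetaH0 (a : H0) :
    HasSum (fun n => ((PowerSeries.coeff n (polylog (a : WordAlg)) : ℚ) : ℝ))
      ((zetaH0 a : algZ) : ℝ) := by
  suffices h : ∀ b ∈ Submodule.span ℚ (yIndex '' {k | Admissible k}), ∀ hb : b ∈ H0,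
      HasSum (fun n => ((PowerSeries.coeff n (polylog b) : ℚ) : ℝ))
        ((zetaH0 ⟨b, hb⟩ : algZ) : ℝ) from h a (H0_le_span a.2) a.2
  intro b hb hb'
  change HasSum _ ((linExt _ b : algZ) : ℝ)
  clear hb'
  induction hb using Submodule.span_induction with
  | mem b h =>
    obtain ⟨k, hk : Admissible k, rfl⟩ := h
    rw [linExt_yIndex, dif_pos hk]
    cases k with
    | nil =>
      have h1 (n : ℕ) : ((PowerSeries.coeff n (polylog (yIndex [])) : ℚ) : ℝ) =
          if n = 0 then 1 else 0 := by
        rw [yIndex_nil, polylog_one, PowerSeries.coeff_one]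
        split_ifs <;> simp
      simp only [h1]
      exact hasSum_ite_eq 0 1
    | cons a k =>
      have hcast (k : Index) (n : ℕ) : ((harmonicSum ℚ k n : ℚ) : ℝ) = harmonicSum ℝ k n := by
        induction k generalizing n with
        | nil => simp [harmonicSum]
        | cons a k ih => simp [harmonicSum, ih]
      simp only [coeff_polylog_yIndex_cons, Rat.cast_mul, hcast, Rat.cast_inv, Rat.cast_pow,
        Rat.cast_natCast]
      exact (summable_mzv a hk k).hasSum
  | zero => simp
  | add b c _ _ hb hc =>
    simp only [map_add, Rat.cast_add]
    exact hb.add hc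
  | smul q b _ hb =>
    have hq (z : algZ) : ((q • z : algZ) : ℝ) = q * z := by
      rw [Subalgebra.coe_smul, Rat.smul_def]
    simp only [map_smul, smul_eq_mul, Rat.cast_mul, hq]
    exact hb.mul_left (q : ℝ)

/-- The map `ζ` is multiplicative for the shuffle product, by Cauchy's product formula for the
absolutely convergent series `Li(1)`. -/
theorem zetaH0_shuffle (a b : H0) (h : shuffle (a : WordAlg) b ∈ H0) :
    zetaH0 ⟨shuffle (a : WordAlg) b, h⟩ = zetaH0 a * zetaH0 b := by
  have ha := hasSum_zetaH0 a
  have hb := hasSum_zetaH0 b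
  have hab := hasSum_zetaH0 ⟨shuffle (a : WordAlg) b, h⟩
  refine Subtype.ext ?_
  rw [Subalgebra.coe_mul, ← hab.tsum_eq, ← ha.tsum_eq, ← hb.tsum_eq,
    tsum_mul_tsum_eq_tsum_sum_antidiagonal_of_summable_norm ha.summable.norm hb.summable.norm]
  refine tsum_congr fun n => ?_
  rw [polylog_shuffle (H0_le_H1 a.2) (H0_le_H1 b.2), PowerSeries.coeff_mul]
  push_cast
  rfl

theorem eval_zero_zetaShPoly (a : H1) :
    (zetaShPoly a).eval 0 = zetaH0 (polyEquiv.symm a 0) := by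
  obtain ⟨c, rfl⟩ := polyEquiv.surjective a
  rw [zetaShPoly, LinearMap.comp_apply, LinearEquiv.coe_coe, LinearEquiv.symm_apply_apply]
  induction c using Finsupp.induction_linear with
  | zero => simp
  | add c d hc hd => rw [map_add, Polynomial.eval_add, hc, hd, Finsupp.add_apply, map_add]
  | single i w =>
    rw [Finsupp.lsum_single]
    rcases Nat.eq_zero_or_pos i with rfl | hi
    · simp
    · simp [hi.ne', Polynomial.eval_monomial]

theorem linExt_zetaSh_fromPoly (c : ℕ →₀ H0) : linExt zetaSh (fromPoly c) = zetaH0 (c 0) := by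
  suffices h : ∀ a ∈ Submodule.span ℚ (Set.range yIndex), ∀ ha : a ∈ H1,
      linExt zetaSh a = zetaH0 (polyEquiv.symm ⟨a, ha⟩ 0) by
    have h1 := fromPoly_mem c
    rw [h _ (H1_eq_span ▸ h1) h1]
    have : (⟨fromPoly c, h1⟩ : H1) = polyEquiv c := rfl
    rw [this, LinearEquiv.symm_apply_apply]
  intro a ha
  induction ha using Submodule.span_induction with
  | mem a h =>
    obtain ⟨k, rfl⟩ := h
    intro hk
    rw [linExt_yIndex, zetaSh, eval_zero_zetaShPoly]
  | zero =>
    intro h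
    have : (⟨0, h⟩ : H1) = 0 := rfl
    rw [this]
    simp
  | add a b ha hb iha ihb =>
    rw [← H1_eq_span] at ha hb
    intro h
    have : (⟨a + b, h⟩ : H1) = ⟨a, ha⟩ + ⟨b, hb⟩ := rfl
    rw [this, map_add, map_add, Finsupp.add_apply, map_add, iha ha, ihb hb]
  | smul q a ha iha =>
    rw [← H1_eq_span] at ha
    intro h
    have : (⟨q • a, h⟩ : H1) = q • ⟨a, ha⟩ := rfl
    rw [this, map_smul, map_smul, Finsupp.smul_apply, map_smul, iha ha]

theorem linExt_zetaSh_H0 (a : H0) : linExt zetaSh (a : WordAlg) = zetaH0 a := by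
  have h := linExt_zetaSh_fromPoly (Finsupp.single 0 a)
  rwa [fromPoly_apply, Finsupp.sum_single_index (by simp), pow_zero, Module.End.one_apply,
    Finsupp.single_eq_same] at h

theorem shuffleX1_apply (a : WordAlg) : shuffleX1 a = shuffle a (x 1) := rfl

/-- The regularization maps `x₁` to `T`, hence multiples of `x₁` to `0` at `T = 0`. -/
theorem linExt_zetaSh_shuffle_x1 {a : WordAlg} (ha : a ∈ H1) :
    linExt zetaSh (shuffle a (x 1)) = 0 := by
  obtain ⟨c, rfl⟩ := H1_le_range ha
  rw [← shuffleX1_apply]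
  induction c using Finsupp.induction_linear with
  | zero => simp
  | add c d hc hd => rw [map_add, map_add, map_add, hc (fromPoly_mem c), hd (fromPoly_mem d),
      add_zero]
  | single i w =>
    have : shuffleX1 (fromPoly (Finsupp.single i w)) = fromPoly (Finsupp.single (i + 1) w) := by
      rw [fromPoly_apply, fromPoly_apply, Finsupp.sum_single_index (by simp),
        Finsupp.sum_single_index (by simp), pow_succ', Module.End.mul_apply]
    rw [this, linExt_zetaSh_fromPoly]
    simp

theorem exists_eq_add_shuffle_x1 {a : WordAlg} (ha : a ∈ H1) :
    ∃ a₀ ∈ H0, ∃ a₁ ∈ H1, a = a₀ + shuffle a₁ (x 1) := by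
  obtain ⟨c, rfl⟩ := H1_le_range ha
  induction c using Finsupp.induction_linear with
  | zero => exact ⟨0, H0.zero_mem, 0, H1.zero_mem, by simp⟩
  | add c d hc hd =>
    obtain ⟨c₀, h1, c₁, h2, h3⟩ := hc (fromPoly_mem c)
    obtain ⟨d₀, h4, d₁, h5, h6⟩ := hd (fromPoly_mem d)
    refine ⟨c₀ + d₀, add_mem h1 h4, c₁ + d₁, add_mem h2 h5, ?_⟩
    rw [map_add, h3, h6, map_add, LinearMap.add_apply]
    abel
  | single i w =>
    rw [fromPoly_apply, Finsupp.sum_single_index (by simp)]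
    cases i with
    | zero => exact ⟨w, w.2, 0, H1.zero_mem, by simp⟩
    | succ i =>
      refine ⟨0, H0.zero_mem, (shuffleX1 ^ i) w, pow_shuffleX1_mem i (H0_le_H1 w.2), ?_⟩
      rw [pow_succ', Module.End.mul_apply, zero_add, shuffleX1_apply]

/-- The shuffle regularization is multiplicative for the shuffle product. -/
theorem linExt_zetaSh_shuffle {a b : WordAlg} (ha : a ∈ H1) (hb : b ∈ H1) :
    linExt zetaSh (shuffle a b) = linExt zetaSh a * linExt zetaSh b := by
  obtain ⟨a₀, ha₀, a₁, ha₁, rfl⟩ := exists_eq_add_shuffle_x1 ha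
  obtain ⟨b₀, hb₀, b₁, hb₁, rfl⟩ := exists_eq_add_shuffle_x1 hb
  have h : shuffle (a₀ + shuffle a₁ (x 1)) (b₀ + shuffle b₁ (x 1)) = shuffle a₀ b₀ +
      (shuffle (shuffle a₀ b₁) (x 1) + shuffle (shuffle a₁ (b₀ + shuffle b₁ (x 1))) (x 1)) := by
    rw [map_add shuffle, LinearMap.add_apply, shuffle_assoc a₁ (x 1), shuffle_comm (x 1),
      ← shuffle_assoc a₁, map_add (shuffle a₀), ← shuffle_assoc a₀]
    abel
  rw [h, map_add (linExt zetaSh), map_add (linExt zetaSh), map_add (linExt zetaSh) a₀,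
    map_add (linExt zetaSh) b₀, linExt_zetaSh_shuffle_x1 ha₁,
    linExt_zetaSh_shuffle_x1 hb₁, linExt_zetaSh_shuffle_x1 (shuffle_mem_H1 (H0_le_H1 ha₀) hb₁),
    linExt_zetaSh_shuffle_x1 (shuffle_mem_H1 ha₁ hb), add_zero, add_zero, add_zero, add_zero]
  have h0 := shuffle_mem_H0 ha₀ hb₀
  rw [linExt_zetaSh_H0 ⟨_, h0⟩, linExt_zetaSh_H0 ⟨_, ha₀⟩, linExt_zetaSh_H0 ⟨_, hb₀⟩]
  exact zetaH0_shuffle ⟨a₀, ha₀⟩ ⟨b₀, hb₀⟩ h0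

/-! ### Splitting words at the letters `x₁` -/

/-- The operator `b ↦ ∑ (-1)^{|A|} (A'b) ⧢ B`, where the sum is over all factorizations
`w = A x₁ B` of the word `w`, and `A'` is the reversed word of `A`. -/
def splitWord : List (Fin 2) → WordAlg →ₗ[ℚ] WordAlg
  | [] => 0
  | u :: w => (if u = 1 then (1 : ℚ) else 0) • shuffle.flip (word w) -
      splitWord w ∘ₗ LinearMap.mulLeft ℚ (x u)

/-- The linear extension of `splitWord` to `𝔥`. -/
def splitAtX1 : WordAlg →ₗ[ℚ] WordAlg →ₗ[ℚ] WordAlg := wordBasis.constr ℚ splitWord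

theorem splitAtX1_word (w : List (Fin 2)) : splitAtX1 (word w) = splitWord w := by
  rw [← wordBasis_apply, splitAtX1, Module.Basis.constr_basis]

theorem splitAtX1_one : splitAtX1 1 = 0 := by rw [← word_nil, splitAtX1_word, splitWord]

theorem splitAtX1_mul (u : Fin 2) (v b : WordAlg) :
    splitAtX1 (x u * v) b =
      (if u = 1 then (1 : ℚ) else 0) • shuffle b v - splitAtX1 v (x u * b) := by
  suffices h : splitAtX1 ∘ₗ LinearMap.mulLeft ℚ (x u) =
      (if u = 1 then (1 : ℚ) else 0) • shuffle.flip -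
        (LinearMap.lcomp ℚ WordAlg (LinearMap.mulLeft ℚ (x u))) ∘ₗ splitAtX1 from
    LinearMap.congr_fun₂ h v b
  refine wordBasis.ext fun w => ?_
  rw [LinearMap.comp_apply, wordBasis_apply, LinearMap.mulLeft_apply, ← word_cons, splitAtX1_word,
    splitWord, LinearMap.sub_apply, LinearMap.smul_apply, LinearMap.comp_apply, splitAtX1_word]
  rfl

/-- The value of `splitAtX1` at a shuffle product. In terms of iterated integrals, the letter `x₁`
at which a shuffle is split belongs to one of the two factors, and path composition recombines the
two pieces of the other factor into a shuffle with `c`. -/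
theorem splitAtX1_shuffle (v v' : WordAlg) (u : Fin 2) (c : WordAlg) :
    splitAtX1 (shuffle v v') (x u * c) =
      splitAtX1 v (x u * shuffle c v') + splitAtX1 v' (x u * shuffle c v) := by
  suffices h : ∀ (w w' : List (Fin 2)) (u : Fin 2) (c : WordAlg),
      splitAtX1 (shuffle (word w) (word w')) (x u * c) =
        splitAtX1 (word w) (x u * shuffle c (word w')) +
          splitAtX1 (word w') (x u * shuffle c (word w)) by
    let M : WordAlg →ₗ[ℚ] WordAlg := LinearMap.mulLeft ℚ (x u)
    have h2 : shuffle.compr₂ (splitAtX1.flip (x u * c)) =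
        splitAtX1.compl₂ (M ∘ₗ shuffle c) + (splitAtX1.compl₂ (M ∘ₗ shuffle c)).flip := by
      refine wordBasis.ext fun w => wordBasis.ext fun w' => ?_
      rw [wordBasis_apply, wordBasis_apply]
      exact h w w' u c
    exact LinearMap.congr_fun₂ h2 v v'
  intro w w'
  induction hn : w.length + w'.length using Nat.strong_induction_on generalizing w w' with
  | _ n ih =>
    intro u c
    match w, w' with
    | [], w' => simp [word_nil, shuffle_one_left, shuffle_one_right, splitAtX1_one]
    | t :: w, [] => simp [word_nil, shuffle_one_right, splitAtX1_one]
    | p :: v, p' :: v' =>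
      simp only [List.length_cons] at hn
      have h1 := ih _ (by simp; omega) v (p' :: v') rfl p (x u * c)
      have h2 := ih _ (by simp; omega) (p :: v) v' rfl p' (x u * c)
      simp only [word_cons] at h1 h2 ⊢
      have e1 : shuffle (x u * c) (shuffle (word v) (x p' * word v')) =
          shuffle (x u * shuffle c (x p' * word v')) (word v) +
            shuffle (x p' * shuffle (x u * c) (word v')) (word v) := by
        rw [shuffle_comm (word v), ← shuffle_assoc, shuffle_mul_mul, map_add, LinearMap.add_apply]
      have e2 : shuffle (x u * c) (shuffle (x p * word v) (word v')) =
          shuffle (x u * shuffle c (x p * word v)) (word v') +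
            shuffle (x p * shuffle (x u * c) (word v)) (word v') := by
        rw [← shuffle_assoc, shuffle_mul_mul, map_add, LinearMap.add_apply]
      have e3 := shuffle_mul_mul u p' c (word v')
      have e4 := shuffle_mul_mul u p c (word v)
      rw [e3, mul_add, map_add, splitAtX1_mul p'] at h1
      rw [e4, mul_add, map_add, splitAtX1_mul p] at h2
      rw [shuffle_mul_mul, map_add, LinearMap.add_apply, splitAtX1_mul p, splitAtX1_mul p', h1, h2,
        e1, e2, splitAtX1_mul p, splitAtX1_mul p']
      module

theorem splitAtX1_shuffleList (L : List WordAlg) (u : Fin 2) (c : WordAlg) :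
    splitAtX1 (shuffleList L) (x u * c) = ∑ j ∈ Finset.range L.length,
      splitAtX1 (L.getD j 1) (x u * shuffle c (shuffleList (L.eraseIdx j))) := by
  induction L generalizing c with
  | nil => simp [shuffleList_nil, splitAtX1_one]
  | cons a L ih =>
    rw [shuffleList_cons, splitAtX1_shuffle, ih, List.length_cons, Finset.sum_range_succ', add_comm]
    simp only [List.getD_cons_zero, List.getD_cons_succ, List.eraseIdx_cons_zero,
      List.eraseIdx_cons_succ, shuffleList_cons, shuffle_assoc]

theorem splitAtX1_x0_pow_mul (n : ℕ) (v b : WordAlg) :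
    splitAtX1 (x 0 ^ n * v) b = (-1 : ℚ) ^ n • splitAtX1 v (x 0 ^ n * b) := by
  induction n generalizing b with
  | zero => simp
  | succ n ih =>
    rw [pow_succ' (x 0), mul_assoc, splitAtX1_mul, if_neg (by decide), zero_smul, zero_sub, ih,
      ← mul_assoc, ← pow_succ, ← pow_succ', pow_succ (-1 : ℚ)]
    module

theorem splitAtX1_y_mul (a : ℕ+) (v b : WordAlg) :
    splitAtX1 (y a * v) b = (-1 : ℚ) ^ (a : ℕ) •
      (splitAtX1 v (x 1 * (x 0 ^ ((a : ℕ) - 1) * b)) - shuffle (x 0 ^ ((a : ℕ) - 1) * b) v) := by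
  rw [y, mul_assoc, splitAtX1_x0_pow_mul, splitAtX1_mul, if_pos rfl, one_smul]
  have : (-1 : ℚ) ^ (a : ℕ) = -(-1) ^ ((a : ℕ) - 1) := by
    conv_lhs => rw [← Nat.sub_add_cancel a.pos, pow_succ]
    ring
  rw [this]
  module

theorem splitAtX1_y (a : ℕ+) (b : WordAlg) :
    splitAtX1 (y a) (x 0 * b) = -(-1 : ℚ) ^ (a : ℕ) • (x 0 ^ (a : ℕ) * b) := by
  have := splitAtX1_y_mul a 1 (x 0 * b)
  rw [mul_one, splitAtX1_one, shuffle_one_right, ← mul_assoc (_ ^ _), ← pow_succ,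
    Nat.sub_add_cancel a.pos] at this
  rw [this]
  simp

/-! ### Symmetric multiple zeta values -/

theorem neg_one_pow_mul {R : Type*} [Ring R] [Algebra ℚ R] (n : ℕ) (a : R) :
    (-1) ^ n * a = (-1 : ℚ) ^ n • a := by
  rw [Algebra.smul_def]
  simp

theorem weight_cons (a : ℕ+) (k : Index) : weight (a :: k) = a + weight k := by simp [weight]

theorem linExt_zetaSh_splitAtX1_yIndex (k l : Index) :
    linExt zetaSh (splitAtX1 (yIndex k) (x 1 * yIndex l)) =
      -∑ a ∈ Finset.range k.length, (-1) ^ weight (k.take (a + 1)) *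
        zetaSh ((k.take (a + 1)).reverse ++ l) * zetaSh (k.drop (a + 1)) := by
  induction k generalizing l with
  | nil => simp [yIndex_nil, splitAtX1_one]
  | cons b k ih =>
    have hy : x 0 ^ ((b : ℕ) - 1) * (x 1 * yIndex l) = yIndex (b :: l) := by
      rw [yIndex_cons, y, mul_assoc]
    rw [yIndex_cons, splitAtX1_y_mul, hy, map_smul, map_sub, ih,
      linExt_zetaSh_shuffle (yIndex_mem _) (yIndex_mem _), linExt_yIndex, linExt_yIndex,
      List.length_cons, Finset.sum_range_succ']
    rw [← neg_one_pow_mul, mul_sub, mul_neg, Finset.mul_sum, neg_add, sub_eq_add_neg]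
    congr 1
    · congr 1
      refine Finset.sum_congr rfl fun a _ => ?_
      simp only [List.take_succ_cons, List.drop_succ_cons, weight_cons, List.reverse_cons, pow_add,
        List.append_assoc, List.singleton_append, mul_assoc]
    · simp [weight, mul_assoc]

/-- The alternating sum defining `ζ_𝒮^⧢` runs over the factorizations of the word of `x₁y_k` at its
letters `x₁`; the first of them gives the first term. -/
theorem linExt_zetaSSh {a : WordAlg} (ha : a ∈ H1) :
    linExt zetaSSh a = linExt zetaSh a - linExt zetaSh (splitAtX1 a (x 1)) := by
  refine eqOn_H1 (f := linExt zetaSSh) (g := linExt zetaSh - linExt zetaSh ∘ₗ splitAtX1.flip (x 1))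
    (fun k => ?_) ha
  rw [LinearMap.sub_apply, LinearMap.comp_apply, LinearMap.flip_apply, linExt_yIndex,
    linExt_yIndex, ← mul_one (x 1), ← yIndex_nil, linExt_zetaSh_splitAtX1_yIndex, sub_neg_eq_add,
    zetaSSh, Finset.sum_range_succ', add_comm]
  -- The term `a = 0` of the definition has the trivial factor `ζ^⧢(∅)`.
  have h0 : zetaSh [] = 1 := by
    have h1 := linExt_yIndex zetaSh []
    have h3 := hasSum_zetaH0 ⟨1, one_mem_H0⟩
    rw [← h1, yIndex_nil, linExt_zetaSh_H0 ⟨1, one_mem_H0⟩]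
    refine Subtype.ext (h3.unique ?_)
    have h1 (n : ℕ) : ((PowerSeries.coeff n (polylog (1 : WordAlg)) : ℚ) : ℝ) =
        if n = 0 then 1 else 0 := by
      rw [polylog_one, PowerSeries.coeff_one]
      split_ifs <;> simp
    simp only [h1]
    exact hasSum_ite_eq 0 1
  simp [h0, weight]

/-- The term of the limit `Ω(k)` that comes from the tuples whose `j`-th entry is of the order
of `n`, with positions counted from `0`. For `k` of length at least `2` the argument of `ζ^⧢` is
in `𝔥⁰`. The default value of `getD` only concerns `j` beyond the length of `k`. -/
def omegaTerm (k : Index) (j : ℕ) : algZ :=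
  (-1) ^ (k.getD j 1 : ℕ) *
    linExt zetaSh (x 0 ^ (k.getD j 1 : ℕ) * shuffleList ((k.eraseIdx j).map y))

/-- The sum of the terms of `Ω(k)` is `± ζ_𝒮^⧢(x₀^{k_r} (y_{k₁} ⧢ ⋯ ⧢ y_{k_{r-1}}))` in `𝒵`, before
reduction modulo `ζ(2)`. The factorization at the first `x₁` gives the last term, those at the
last letter of `y_{k_j}` give the `j`-th term. -/
theorem sum_omegaTerm (k : Index) (hk : k ≠ []) (h2 : 2 ≤ k.length) :
    ∑ j ∈ Finset.range k.length, omegaTerm k j =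
      (-1) ^ (k.getLast hk : ℕ) * linExt zetaSSh (omegaWord k hk) := by
  rw [linExt_zetaSSh (omegaWord_mem_H1 k hk h2)]
  obtain ⟨k, l, rfl⟩ : ∃ k' l, k = k' ++ [l] := by
    rcases List.eq_nil_or_concat k with h | ⟨b, l, h⟩
    · exact absurd h hk
    · exact ⟨b, l, by simpa using h⟩
  have hx : x 0 ^ (l : ℕ) * x 1 = x 0 * y l := by
    rw [y, ← mul_assoc, ← pow_succ', Nat.sub_add_cancel l.pos]
  rw [omegaWord, List.getLast_append_singleton, List.dropLast_concat, splitAtX1_x0_pow_mul, hx,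
    splitAtX1_shuffleList, mul_sub, map_smul, ← neg_one_pow_mul,
    ← mul_assoc ((-1) ^ (l : ℕ)), ← pow_add, Even.neg_one_pow ⟨_, rfl⟩, one_mul,
    List.length_append, List.length_singleton, Finset.sum_range_succ, List.length_map, map_sum,
    sub_eq_add_neg, add_comm]
  congr 1
  · simp [omegaTerm, List.eraseIdx_append_of_length_le]
  · rw [← Finset.sum_neg_distrib]
    refine Finset.sum_congr rfl fun j hj => ?_
    have hj := Finset.mem_range.1 hj
    have h1 : (k.map y).getD j 1 = y (k.getD j 1) := by
      simp [hj]
    have h3 : shuffleList (((k ++ [l]).eraseIdx j).map y) =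
        shuffle (y l) (shuffleList ((k.map y).eraseIdx j)) := by
      rw [List.eraseIdx_append_of_lt_length hj, ← shuffleList_cons, List.eraseIdx_map,
        ← List.map_cons]
      exact shuffleList_perm ((List.perm_append_singleton _ _).map y)
    rw [omegaTerm, h1, splitAtX1_y, map_smul, neg_smul, neg_neg, ← neg_one_pow_mul, h3,
      List.getD_append _ _ _ _ hj]

/-! ### Powers of `e^{2πi/n}` and `q`-integers -/

/-- The root of unity `e^{2πi/n}`. -/
def rootN (n : ℕ) : ℂ := Complex.exp (2 * Real.pi * Complex.I / n)

/-- The factor `q^{(l-1)m} / [m]^l` of a summand of `ω_n(k; q)`, at `q = e^{2πi/n}`. -/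
def qFactor (n l m : ℕ) : ℂ := rootN n ^ ((l - 1) * m) / qInt (rootN n) m ^ l

theorem isPrimitiveRoot_rootN {n : ℕ} (hn : n ≠ 0) : IsPrimitiveRoot (rootN n) n :=
  Complex.isPrimitiveRoot_exp n hn

theorem norm_rootN {n : ℕ} (hn : n ≠ 0) : ‖rootN n‖ = 1 :=
  (isPrimitiveRoot_rootN hn).norm'_eq_one hn

theorem tendsto_rootN : Tendsto rootN atTop (𝓝 1) := by
  have h : Tendsto (fun n : ℕ => 2 * Real.pi * Complex.I / n) atTop (𝓝 0) :=
    tendsto_const_div_atTop_nhds_zero_nat _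
  have h2 := (Complex.continuous_exp.tendsto 0).comp h
  rw [Complex.exp_zero] at h2
  exact h2

theorem tendsto_qInt (m : ℕ) : Tendsto (fun n => qInt (rootN n) m) atTop (𝓝 m) := by
  have h : Tendsto (fun n => qInt (rootN n) m) atTop (𝓝 (∑ i ∈ Finset.range m, (1 : ℂ) ^ i)) :=
    tendsto_finsetSum _ fun i _ => tendsto_rootN.pow i
  simpa using h

theorem tendsto_qFactor (l : ℕ) {m : ℕ} (hm : 0 < m) :
    Tendsto (fun n => qFactor n l m) atTop (𝓝 ((m : ℂ) ^ l)⁻¹) := by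
  have hm' : (m : ℂ) ^ l ≠ 0 := pow_ne_zero _ (by exact_mod_cast hm.ne')
  have h := (tendsto_rootN.pow ((l - 1) * m)).div ((tendsto_qInt m).pow l) hm'
  rw [one_pow, one_div] at h
  exact h

/-- `[n - m] = -q^{-m}[m]` for an `n`-th root of unity `q ≠ 1`. -/
theorem rootN_pow_mul_qInt_sub {n m : ℕ} (hn : 2 ≤ n) (hm : m ≤ n) :
    rootN n ^ m * qInt (rootN n) (n - m) = -qInt (rootN n) m := by
  have hp := isPrimitiveRoot_rootN (n := n) (by omega)
  have h : qInt (rootN n) n = 0 := hp.geom_sum_eq_zero (by omega)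
  have h2 : qInt (rootN n) n = qInt (rootN n) m + rootN n ^ m * qInt (rootN n) (n - m) := by
    unfold qInt
    have h3 := Finset.sum_range_add (fun i => rootN n ^ i) m (n - m)
    rw [Nat.add_sub_cancel' hm] at h3
    rw [h3, Finset.mul_sum]
    simp only [pow_add]
  rw [h] at h2
  linear_combination -h2

/-- The factor at an entry `n - m` close to `n`; the powers of `q` combine to `q^m` as `q^n = 1`. -/
theorem qFactor_sub {n l m : ℕ} (hn : 2 ≤ n) (hl : 0 < l) (hm : m ≤ n) :
    qFactor n l (n - m) = (-1) ^ l * (rootN n ^ m / qInt (rootN n) m ^ l) := by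
  have hp := isPrimitiveRoot_rootN (n := n) (by omega)
  have h := rootN_pow_mul_qInt_sub hn hm
  have hq : rootN n ≠ 0 := hp.ne_zero (by omega)
  have h1 : qInt (rootN n) m = -1 * rootN n ^ m * qInt (rootN n) (n - m) := by
    linear_combination h
  have h2 : rootN n ^ ((l - 1) * (n - m)) * (rootN n ^ m) ^ l = rootN n ^ m := by
    obtain ⟨l, rfl⟩ : ∃ l', l = l' + 1 := ⟨l - 1, by omega⟩
    rw [← pow_mul, ← pow_add]
    have : (l + 1 - 1) * (n - m) + m * (l + 1) = n * l + m := by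
      obtain ⟨d, rfl⟩ := Nat.exists_eq_add_of_le hm
      simp only [Nat.add_sub_cancel, Nat.add_sub_cancel_left]
      ring
    rw [this, pow_add, pow_mul, hp.pow_eq_one, one_pow, one_mul]
  rw [qFactor, h1, mul_pow, mul_pow]
  have h3 : rootN n ^ ((l - 1) * (n - m)) = rootN n ^ m / (rootN n ^ m) ^ l := by
    rw [eq_div_iff (pow_ne_zero _ (pow_ne_zero _ hq)), h2]
  have h4 : ((-1 : ℂ) ^ l) * ((-1) ^ l)⁻¹ = 1 := mul_inv_cancel₀ (pow_ne_zero _ (by norm_num))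
  rw [h3]
  simp only [div_eq_mul_inv, mul_inv]
  linear_combination -(rootN n ^ m * ((rootN n ^ m) ^ l)⁻¹ * (qInt (rootN n) (n - m) ^ l)⁻¹) * h4

theorem tendsto_qFactor_sub {l m : ℕ} (hl : 0 < l) (hm : 0 < m) :
    Tendsto (fun n => qFactor n l (n - m)) atTop (𝓝 ((-1) ^ l * ((m : ℂ) ^ l)⁻¹)) := by
  have hm' : (m : ℂ) ^ l ≠ 0 := pow_ne_zero _ (by exact_mod_cast hm.ne')
  have h := ((tendsto_rootN.pow m).div ((tendsto_qInt m).pow l) hm').const_mul ((-1 : ℂ) ^ l)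
  rw [one_pow, one_div] at h
  refine h.congr' ?_
  filter_upwards [eventually_ge_atTop (m + 2)] with n hn
  exact (qFactor_sub (by omega) hl (by omega)).symm

theorem le_sin_of_le_pi {t : ℝ} (h0 : 0 ≤ t) (h1 : t ≤ 1) :
    2 * (t * (1 - t)) ≤ Real.sin (Real.pi * t) := by
  have hpi := Real.pi_pos
  rcases le_total t (1 / 2) with h | h
  · have := Real.mul_le_sin (x := Real.pi * t) (by positivity) (by nlinarith)
    rw [← mul_assoc, div_mul_cancel₀ _ hpi.ne'] at this
    nlinarith
  · have := Real.mul_le_sin (x := Real.pi * (1 - t)) (by nlinarith) (by nlinarith)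
    rw [← mul_assoc, div_mul_cancel₀ _ hpi.ne', mul_one_sub Real.pi t, Real.sin_pi_sub] at this
    nlinarith

theorem norm_rootN_pow_sub_one {n : ℕ} (m : ℕ) :
    ‖rootN n ^ m - 1‖ = 2 * |Real.sin (Real.pi * (m / n))| := by
  have h : rootN n ^ m = Complex.exp (Complex.I * ((2 * Real.pi * (m / n) : ℝ) : ℂ)) := by
    rw [rootN, ← Complex.exp_nat_mul]
    congr 1
    push_cast
    ring
  rw [h, Complex.norm_exp_I_mul_ofReal_sub_one, Real.norm_eq_abs, abs_mul, abs_two]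
  congr 3
  ring

/-- If `m` is not too close to `n`, then `[m]` is at least of the order of `m`. -/
theorem le_norm_qInt {n m R : ℕ} (hn : 2 ≤ n) (hm : m ≤ n) (hR : n ≤ R * (n - m)) :
    (m : ℝ) / (2 * R) ≤ ‖qInt (rootN n) m‖ := by
  have hn0 : (0 : ℝ) < n := by positivity
  have hR0 : 0 < R := by
    rcases Nat.eq_zero_or_pos R with rfl | h
    · omega
    · exact h
  have hR1 : (0 : ℝ) < R := by exact_mod_cast hR0
  have h1 : ‖qInt (rootN n) m‖ * ‖rootN n - 1‖ = ‖rootN n ^ m - 1‖ := by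
    rw [← norm_mul, qInt, geom_sum_mul]
  have h2 : ‖rootN n - 1‖ ≤ 2 * (Real.pi / n) := by
    have := norm_rootN_pow_sub_one (n := n) 1
    rw [pow_one] at this
    rw [this]
    have h3 := Real.abs_sin_le_abs (x := Real.pi * ((1 : ℕ) / n))
    rw [abs_of_nonneg (a := Real.pi * ((1 : ℕ) / n)) (by positivity)] at h3
    rw [Nat.cast_one] at h3 ⊢
    rw [← mul_one_div Real.pi]
    linarith
  have hmn : (m : ℝ) / n ≤ 1 := by
    rw [div_le_one hn0]
    exact_mod_cast hm
  have h3 : 2 * (2 * ((m : ℝ) / n * (1 - m / n))) ≤ ‖rootN n ^ m - 1‖ := by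
    rw [norm_rootN_pow_sub_one]
    exact mul_le_mul_of_nonneg_left
      ((le_sin_of_le_pi (by positivity) hmn).trans (le_abs_self _)) (by norm_num)
  have h4 : (R : ℝ)⁻¹ ≤ 1 - m / n := by
    have : (n : ℝ) ≤ R * (n - m) := by
      rw [← Nat.cast_sub hm]
      exact_mod_cast hR
    rw [inv_le_iff_one_le_mul₀ hR1, one_sub_div hn0.ne', ← mul_div_right_comm, le_div_iff₀ hn0]
    linarith
  have h5 : 4 * ((m : ℝ) / n * (R : ℝ)⁻¹) ≤ ‖qInt (rootN n) m‖ * (2 * (Real.pi / n)) := by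
    calc 4 * ((m : ℝ) / n * (R : ℝ)⁻¹) ≤ 4 * ((m : ℝ) / n * (1 - m / n)) := by gcongr
      _ ≤ ‖qInt (rootN n) m‖ * ‖rootN n - 1‖ := by rw [h1]; linarith
      _ ≤ _ := by gcongr
  have h6 : 4 * ((m : ℝ) * (R : ℝ)⁻¹) ≤ ‖qInt (rootN n) m‖ * (2 * Real.pi) := by
    have := mul_le_mul_of_nonneg_right h5 hn0.le
    calc 4 * ((m : ℝ) * (R : ℝ)⁻¹) = 4 * ((m : ℝ) / n * (R : ℝ)⁻¹) * n := by field_simp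
      _ ≤ _ := this
      _ = _ := by field_simp
  -- So far `‖[m]‖ ≥ (2 / π) m / R`; the constant is weakened to `1 / 2` by `π < 4`.
  have h7 : (m : ℝ) / (2 * R) = (m : ℝ) * (R : ℝ)⁻¹ / 2 := by field_simp
  rw [h7]
  have := Real.pi_lt_four
  nlinarith [norm_nonneg (qInt (rootN n) m)]

theorem norm_rootN_pow_div_le {n m R : ℕ} (l b : ℕ) (hn : 2 ≤ n) (hm : m ≤ n) (hm0 : 0 < m)
    (hR : n ≤ R * (n - m)) :
    ‖rootN n ^ b / qInt (rootN n) m ^ l‖ ≤ (2 * R) ^ l * ((m : ℝ) ^ l)⁻¹ := by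
  have h := le_norm_qInt hn hm hR
  have hR0 : 0 < R := by
    rcases Nat.eq_zero_or_pos R with rfl | h
    · omega
    · exact h
  rw [norm_div, norm_pow, norm_pow, norm_rootN (by omega), one_pow, one_div]
  calc (‖qInt (rootN n) m‖ ^ l)⁻¹ ≤ (((m : ℝ) / (2 * R)) ^ l)⁻¹ := by
        gcongr
    _ = _ := by rw [div_pow, inv_div, div_eq_mul_inv]

/-! ### The limit of `ω_n(k; e^{2πi/n})` -/

theorem omegaRoot_of_length {k : Index} {r : ℕ} (h : r = k.length) (n : ℕ) :
    omegaRoot k n = ∑ m ∈ positiveTuples r n, ∏ a, qFactor n (k.get (a.cast h)) (m a) := by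
  subst h
  rfl

/-- The sum over all tuples of positive integers of `∏ m_a^{-k_a} (∑ m_a)^{-l}` (terms with some
`m_a = 0` vanish), a Mordell-Tornheim zeta value, is `ζ(x₀^l (y_{k₁} ⧢ ⋯ ⧢ y_{k_r}))`. -/
theorem hasSum_mordellTornheim {k : Index} {r : ℕ} (h : r = k.length) (hk : k ≠ []) (l : ℕ)
    (hl : 0 < l) :
    HasSum (fun m : Fin r → ℕ => (((∑ a, m a : ℕ) : ℝ) ^ l)⁻¹ *
        ∏ a, ((m a : ℝ) ^ (k.get (a.cast h) : ℕ))⁻¹)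
      ((linExt zetaSh (x 0 ^ l * shuffleList (k.map y)) : algZ) : ℝ) := by
  set T : (Fin r → ℕ) → ℝ := fun m => (((∑ a, m a : ℕ) : ℝ) ^ l)⁻¹ *
        ∏ a, ((m a : ℝ) ^ (k.get (a.cast h) : ℕ))⁻¹ with hT
  have hH0 := x0_pow_mul_mem_H0 l hl.ne' (shuffleList_y_mem_rightX1 hk)
  have h1 := hasSum_zetaH0 ⟨_, hH0⟩
  rw [← linExt_zetaSh_H0] at h1
  simp only [coeff_polylog_x0_pow_mul, coeff_polylog_shuffleList] at h1
  -- The tuples of sum `s` contribute the `s`-th coefficient of the polylogarithm.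
  have hfib (s : ℕ) : HasSum (fun c : {m : Fin r → ℕ // ∑ a, m a = s} => T c)
      ((((s : ℚ) ^ l)⁻¹ * omegaN s k : ℚ) : ℝ) := by
    have h2 : HasSum (Set.indicator {m : Fin r → ℕ | ∑ a, m a = s} T)
        (∑ m ∈ positiveTuples r s, Set.indicator {m : Fin r → ℕ | ∑ a, m a = s} T m) := by
      refine hasSum_sum_of_ne_finset_zero fun m hm => ?_
      by_cases hs : ∑ a, m a = s
      · rw [Set.indicator_of_mem (by exact hs)]
        have : ∃ a, m a = 0 := by
          by_contra hne
          push Not at hne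
          exact hm (mem_positiveTuples.2 ⟨hs, fun a => Nat.pos_of_ne_zero (hne a)⟩)
        obtain ⟨a, ha⟩ := this
        simp only [hT]
        rw [Finset.prod_eq_zero (Finset.mem_univ a), mul_zero]
        simp [ha]
      · exact Set.indicator_of_notMem (by exact hs) _
    have h3 : ∑ m ∈ positiveTuples r s, Set.indicator {m : Fin r → ℕ | ∑ a, m a = s} T m =
        ((((s : ℚ) ^ l)⁻¹ * omegaN s k : ℚ) : ℝ) := by
      rw [omegaN_of_length h, Finset.mul_sum]
      push_cast
      refine Finset.sum_congr rfl fun m hm => ?_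
      have hs := (mem_positiveTuples.1 hm).1
      rw [Set.indicator_of_mem (by exact hs)]
      simp only [hT, hs, one_div]
    rw [h3] at h2
    exact hasSum_subtype_iff_indicator.2 h2
  rw [← (Equiv.sigmaFiberEquiv fun m : Fin r → ℕ => ∑ a, m a).hasSum_iff]
  have hs : Summable (T ∘ Equiv.sigmaFiberEquiv fun m : Fin r → ℕ => ∑ a, m a) := by
    refine (summable_sigma_of_nonneg fun c => ?_).2 ⟨fun s => (hfib s).summable, ?_⟩
    · simp only [Function.comp_apply, hT]
      positivity
    · exact h1.summable.congr fun s => (hfib s).tsum_eq.symm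
  have h4 := hs.hasSum.sigma (g := fun s : ℕ => ((((s : ℚ) ^ l)⁻¹ * omegaN s k : ℚ) : ℝ)) hfib
  rw [← h4.unique h1]
  exact hs.hasSum

/-- The position of a largest entry of a tuple, chosen arbitrarily among several. -/
def argmaxEntry {r : ℕ} (m : Fin (r + 1) → ℕ) : Fin (r + 1) :=
  (Finset.exists_max_image Finset.univ m Finset.univ_nonempty).choose

theorem le_argmaxEntry {r : ℕ} (m : Fin (r + 1) → ℕ) (a : Fin (r + 1)) :
    m a ≤ m (argmaxEntry m) :=
  (Finset.exists_max_image Finset.univ m Finset.univ_nonempty).choose_spec.2 a (Finset.mem_univ a)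

/-- The part of the sum `ω_n(k; e^{2πi/n})` in which the `j`-th entry is the chosen largest one
converges to the `j`-th term of the limit, by dominated convergence: a largest entry is at least
`n / (r + 1)`, so that `[m_j] = -q^{-s}[s]`, with `s` the sum of the other entries, is at least of
the order of `s`. -/
theorem tendsto_omegaRoot_part {k : Index} {r : ℕ} (h : r + 1 = k.length) (hr : 0 < r)
    (j : Fin (r + 1)) :
    Tendsto (fun n => ∑ m ∈ positiveTuples (r + 1) n,
        if argmaxEntry m = j then ∏ a, qFactor n (k.get (a.cast h)) (m a) else 0)
      atTop (𝓝 (((omegaTerm k j : algZ) : ℝ) : ℂ)) := by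
  classical
  set l : ℕ := PNat.val (k.get (j.cast h)) with hl
  have hl0 : 0 < l := (k.get (j.cast h)).pos
  set e : Fin r → ℕ := fun i =>
    PNat.val ((k.eraseIdx j).get (i.cast (length_eraseIdx_of_succ h j))) with he
  have hne : k.eraseIdx j ≠ [] := fun h0 => by
    have := length_eraseIdx_of_succ h j
    rw [h0] at this
    simp at this
    omega
  have hsum := hasSum_mordellTornheim (length_eraseIdx_of_succ h j) hne l hl0
  -- The summand as a function of the entries other than the `j`-th, extended by `0`.
  let G : ℕ → (Fin r → ℕ) → ℂ := fun n m =>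
    if (∀ i, 0 < m i) ∧ ∑ i, m i < n ∧
        argmaxEntry (j.insertNth (n - ∑ i, m i) m : Fin (r + 1) → ℕ) = j then
      qFactor n l (n - ∑ i, m i) * ∏ i, qFactor n (e i) (m i) else 0
  have hG (n : ℕ) : ∑' m, G n m = ∑ m ∈ positiveTuples (r + 1) n,
      if argmaxEntry m = j then ∏ a, qFactor n (k.get (a.cast h)) (m a) else 0 := by
    rw [sum_positiveTuples_succ j, tsum_eq_sum (s := (Finset.range n).biUnion (positiveTuples r)),
      Finset.sum_biUnion]
    · refine Finset.sum_congr rfl fun s hs => Finset.sum_congr rfl fun m hm => ?_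
      obtain ⟨h1, h2⟩ := mem_positiveTuples.1 hm
      subst h1
      simp only [G, Fin.prod_univ_succAbove _ j, Fin.insertNth_apply_same,
        Fin.insertNth_apply_succAbove, get_succAbove h j, Finset.mem_range.1 hs, h2,
        implies_true, true_and]
      rfl
    · intro s _ t _ hst
      refine Finset.disjoint_left.2 fun m hm hm' => hst ?_
      rw [← (mem_positiveTuples.1 hm).1, (mem_positiveTuples.1 hm').1]
    · intro m hm
      refine if_neg fun hc => hm ?_
      rw [Finset.mem_biUnion]
      exact ⟨_, Finset.mem_range.2 hc.2.1, mem_positiveTuples.2 ⟨rfl, hc.1⟩⟩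
  let C : ℝ := (2 * (r + 1 : ℕ)) ^ l * ∏ i, (2 * (r + 1 : ℕ) : ℝ) ^ e i
  have hlim := tendsto_tsum_of_dominated_convergence (𝓕 := atTop) (f := G)
    (g := fun m => (-1) ^ l * ((((∑ i, m i : ℕ) : ℝ) ^ l)⁻¹ * ∏ i, ((m i : ℝ) ^ e i)⁻¹ : ℝ))
    (hsum.summable.mul_left C) (fun m => ?_) ?_
  · simp only [hG] at hlim
    have h1 : Tendsto (fun n => ∑ m ∈ positiveTuples (r + 1) n,
        if argmaxEntry m = j then ∏ a, qFactor n (k.get (a.cast h)) (m a) else 0) atTop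
        (𝓝 _) := hlim
    convert h1 using 2
    rw [tsum_mul_left, ← Complex.ofReal_tsum, hsum.tsum_eq, omegaTerm]
    have : k.getD j 1 = k.get (j.cast h) := by
      rw [List.getD_eq_getElem _ _ (by omega)]
      rfl
    rw [this]
    push_cast
    rfl
  · by_cases hm : ∀ i, 0 < m i
    · have hpos : 0 < ∑ i, m i := Finset.sum_pos (fun i _ => hm i) ⟨⟨0, hr⟩, Finset.mem_univ _⟩
      have h1 := (tendsto_qFactor_sub hl0 hpos).mul
        (tendsto_finsetProd Finset.univ fun i _ => tendsto_qFactor (e i) (hm i))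
      have h2 : ((-1) ^ l * (((∑ i, m i : ℕ) : ℂ) ^ l)⁻¹) * ∏ i, ((m i : ℂ) ^ e i)⁻¹ =
          (-1) ^ l * ((((∑ i, m i : ℕ) : ℝ) ^ l)⁻¹ * ∏ i, ((m i : ℝ) ^ e i)⁻¹ : ℝ) := by
        push_cast
        ring
      rw [← h2]
      refine h1.congr' ?_
      filter_upwards [eventually_gt_atTop (2 * ∑ i, m i)] with n hn
      -- For `n > 2 ∑ m_i` the `j`-th entry `n - ∑ m_i` is strictly larger than all the others.
      refine (if_pos ⟨hm, by omega, ?_⟩).symm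
      by_contra hc
      obtain ⟨i, hi⟩ := Fin.exists_succAbove_eq hc
      have h3 := le_argmaxEntry (j.insertNth (n - ∑ i, m i) m : Fin (r + 1) → ℕ) j
      rw [← hi, Fin.insertNth_apply_same, Fin.insertNth_apply_succAbove] at h3
      have := Finset.single_le_sum (f := m) (fun _ _ => Nat.zero_le _) (Finset.mem_univ i)
      omega
    · have h0 : ∏ i, ((m i : ℝ) ^ e i)⁻¹ = 0 := by
        push Not at hm
        obtain ⟨i, hi⟩ := hm
        refine Finset.prod_eq_zero (Finset.mem_univ i) ?_
        simp [Nat.le_zero.1 hi, he]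
      have h1 : (fun n => G n m) = fun _ => 0 := funext fun n => if_neg fun hc => hm hc.1
      rw [h1, h0]
      simp
  · filter_upwards [eventually_ge_atTop 2] with n hn
    intro m
    have hnn : 0 ≤ C * ((((∑ i, m i : ℕ) : ℝ) ^ l)⁻¹ * ∏ i, ((m i : ℝ) ^ e i)⁻¹) := by
      positivity
    by_cases hc : (∀ i, 0 < m i) ∧ ∑ i, m i < n ∧
        argmaxEntry (j.insertNth (n - ∑ i, m i) m : Fin (r + 1) → ℕ) = j
    · simp only [G, if_pos hc]
      obtain ⟨h1, h2, h3⟩ := hc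
      have h4 (i : Fin r) : m i ≤ n - ∑ i, m i := by
        have := le_argmaxEntry (j.insertNth (n - ∑ i, m i) m : Fin (r + 1) → ℕ) (j.succAbove i)
        rwa [h3, Fin.insertNth_apply_same, Fin.insertNth_apply_succAbove] at this
      have h5 : n ≤ (r + 1) * (n - ∑ i, m i) := by
        have : ∑ i, m i ≤ r * (n - ∑ i, m i) := by
          simpa using Finset.sum_le_sum fun i (_ : i ∈ Finset.univ) => h4 i
        rw [add_mul, one_mul]
        omega
      have h6 (i : Fin r) : m i ≤ ∑ i, m i :=
        Finset.single_le_sum (f := m) (fun _ _ => Nat.zero_le _) (Finset.mem_univ i)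
      have hpos : 0 < ∑ i, m i := Finset.sum_pos (fun i _ => h1 i) ⟨⟨0, hr⟩, Finset.mem_univ _⟩
      have b1 : ‖qFactor n l (n - ∑ i, m i)‖ ≤
          (2 * (r + 1 : ℕ)) ^ l * (((∑ i, m i : ℕ) : ℝ) ^ l)⁻¹ := by
        rw [qFactor_sub hn hl0 h2.le, norm_mul, norm_pow, norm_neg, norm_one, one_pow, one_mul]
        exact norm_rootN_pow_div_le l _ hn h2.le hpos h5
      have b2 (i : Fin r) : ‖qFactor n (e i) (m i)‖ ≤
          (2 * (r + 1 : ℕ)) ^ e i * ((m i : ℝ) ^ e i)⁻¹ := by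
        refine norm_rootN_pow_div_le (e i) _ hn ((h6 i).trans h2.le) (h1 i) (h5.trans ?_)
        exact Nat.mul_le_mul_left _ (Nat.sub_le_sub_left (h6 i) n)
      rw [norm_mul, norm_prod]
      calc _ ≤ ((2 * (r + 1 : ℕ)) ^ l * (((∑ i, m i : ℕ) : ℝ) ^ l)⁻¹) *
            ∏ i, ((2 * (r + 1 : ℕ)) ^ e i * ((m i : ℝ) ^ e i)⁻¹) := by
            refine mul_le_mul b1 (Finset.prod_le_prod (fun _ _ => norm_nonneg _) fun i _ => b2 i)
              (by positivity) (by positivity)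
        _ = _ := by
          rw [Finset.prod_mul_distrib]
          simp only [C]
          ring
    · simp only [G, if_neg hc, norm_zero]
      exact hnn

theorem tendsto_omegaRoot (k : Index) (h2 : 2 ≤ k.length) :
    Tendsto (omegaRoot k) atTop
      (𝓝 (((∑ j ∈ Finset.range k.length, omegaTerm k j : algZ) : ℝ) : ℂ)) := by
  obtain ⟨r, h⟩ : ∃ r, r + 1 = k.length := ⟨k.length - 1, by omega⟩
  have h1 := tendsto_finsetSum Finset.univ fun (j : Fin (r + 1)) _ =>
    tendsto_omegaRoot_part h (by omega) j
  have h3 (n : ℕ) : ∑ j : Fin (r + 1), (∑ m ∈ positiveTuples (r + 1) n,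
      if argmaxEntry m = j then ∏ a, qFactor n (k.get (a.cast h)) (m a) else 0) =
      omegaRoot k n := by
    rw [Finset.sum_comm, omegaRoot_of_length h]
    refine Finset.sum_congr rfl fun m _ => ?_
    rw [Finset.sum_ite_eq, if_pos (Finset.mem_univ _)]
  simp only [h3] at h1
  convert h1 using 2
  rw [← h, Finset.sum_range]
  push_cast
  rfl

/-! ### Symmetric multiple omega values -/

theorem Omega_eq (k : Index) (h2 : 2 ≤ k.length) :
    Omega k = (((∑ j ∈ Finset.range k.length, omegaTerm k j : algZ) : ℝ) : ℂ) :=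
  (tendsto_omegaRoot k h2).limUnder_eq

theorem linExt_zetaS (a : WordAlg) : linExt zetaS a = modZetaTwo (linExt zetaSSh a) := by
  let f : algZ →ₗ[ℚ] QuotZ := (Ideal.Quotient.mkₐ ℚ (Ideal.span {zetaTwo})).toLinearMap
  suffices h : linExt zetaS = f ∘ₗ linExt zetaSSh from LinearMap.congr_fun h a
  refine wordBasis.ext fun w => ?_
  rw [LinearMap.comp_apply, linExt, linExt, Module.Basis.constr_basis, Module.Basis.constr_basis]
  by_cases hw : ∃ k, yWord k = w
  · obtain ⟨k, rfl⟩ := hw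
    rw [yWord_injective.extend_apply, yWord_injective.extend_apply]
    rfl
  · rw [Function.extend_apply' _ _ _ hw, Function.extend_apply' _ _ _ hw, Pi.zero_apply,
      Pi.zero_apply, map_zero]

theorem omegaS_eq (k : Index) (hk : k ≠ []) (h2 : 2 ≤ k.length) :
    omegaS k = (-1) ^ (k.getLast hk : ℕ) * linExt zetaS (omegaWord k hk) := by
  have h : ∃ z : algZ, ((z : ℝ) : ℂ) = Omega k := ⟨_, (Omega_eq k h2).symm⟩
  have h1 : h.choose = ∑ j ∈ Finset.range k.length, omegaTerm k j := by
    have := h.choose_spec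
    exact Subtype.ext (Complex.ofReal_injective (this.trans (Omega_eq k h2)))
  rw [omegaS, dif_pos h, h1, sum_omegaTerm k hk h2, linExt_zetaS, map_mul, map_pow, map_neg,
    map_one]

/-! ### Comparison of the finite and the symmetric side -/

/-- The element of `𝔥¹` at which `ζ_𝒜` and `ζ_𝒮` take the values `ω_𝒜(k)` and `ω_𝒮(k)`. It is set
to `0` for indices of length less than `2`, which have no omega values. -/
def omegaElement (k : Index) : H1 :=
  if h : 2 ≤ k.length then
    (-1 : ℚ) ^ (k.getLast (by rintro rfl; simp at h) : ℕ) •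
      ⟨omegaWord k (by rintro rfl; simp at h), omegaWord_mem_H1 k _ h⟩
  else 0

theorem linExt_zetaA_omegaElement {k : Index} (h : 2 ≤ k.length) :
    (linExt zetaA).domRestrict H1 (omegaElement k) = omegaA k := by
  have hk : k ≠ [] := by rintro rfl; simp at h
  rw [omegaElement, dif_pos h, map_smul, omegaA_eq k hk h, neg_one_pow_mul]
  rfl

theorem linExt_zetaS_omegaElement {k : Index} (h : 2 ≤ k.length) :
    (linExt zetaS).domRestrict H1 (omegaElement k) = omegaS k := by
  have hk : k ≠ [] := by rintro rfl; simp at h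
  rw [omegaElement, dif_pos h, map_smul, omegaS_eq k hk h, neg_one_pow_mul]
  rfl

/-- Two linear maps with the same kernel have isomorphic images of any subspace. -/
theorem exists_equiv_map_of_ker_eq {K V M N : Type*} [Field K] [AddCommGroup V] [Module K V]
    [AddCommGroup M] [Module K M] [AddCommGroup N] [Module K N] {f : V →ₗ[K] M} {g : V →ₗ[K] N}
    (h : LinearMap.ker f = LinearMap.ker g) (W : Submodule K V) :
    ∃ φ : W.map f ≃ₗ[K] W.map g, ∀ (v : V) (hv : v ∈ W),
      φ ⟨f v, Submodule.mem_map_of_mem hv⟩ = ⟨g v, Submodule.mem_map_of_mem hv⟩ := by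
  let f' : W →ₗ[K] W.map f := f.submoduleMap W
  let g' : W →ₗ[K] W.map g := g.submoduleMap W
  have hf : Function.Surjective f' := f.submoduleMap_surjective W
  have hg : Function.Surjective g' := g.submoduleMap_surjective W
  have hker : LinearMap.ker f' = LinearMap.ker g' := by
    ext w
    have : (w : V) ∈ LinearMap.ker f ↔ (w : V) ∈ LinearMap.ker g := by rw [h]
    simpa [f', g', ← Subtype.coe_inj, LinearMap.mem_ker] using this
  refine ⟨(f'.quotKerEquivOfSurjective hf).symm ≪≫ₗ Submodule.quotEquivOfEq _ _ hker ≪≫ₗ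
    g'.quotKerEquivOfSurjective hg, fun v hv => ?_⟩
  have h1 : (⟨f v, Submodule.mem_map_of_mem hv⟩ : W.map f) =
      f'.quotKerEquivOfSurjective hf (Submodule.Quotient.mk ⟨v, hv⟩) := rfl
  rw [h1, LinearEquiv.trans_apply, LinearEquiv.trans_apply, LinearEquiv.symm_apply_apply]
  rfl

theorem omegaConjecture_of_ker_eq
    (h : LinearMap.ker ((linExt zetaA).domRestrict H1) =
      LinearMap.ker ((linExt zetaS).domRestrict H1)) : OmegaConjecture := by
  intro w _
  let S : Set Index := {k | 2 ≤ k.length ∧ weight k = w}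
  let W : Submodule ℚ H1 := Submodule.span ℚ (omegaElement '' S)
  have hA : spaceOmegaA w = W.map ((linExt zetaA).domRestrict H1) := by
    rw [Submodule.map_span, Set.image_image, spaceOmegaA]
    exact congrArg _ (Set.image_congr fun k hk => (linExt_zetaA_omegaElement hk.1).symm)
  have hS : spaceOmegaS w = W.map ((linExt zetaS).domRestrict H1) := by
    rw [Submodule.map_span, Set.image_image, spaceOmegaS]
    exact congrArg _ (Set.image_congr fun k hk => (linExt_zetaS_omegaElement hk.1).symm)
  obtain ⟨φ, hφ⟩ := exists_equiv_map_of_ker_eq h W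
  refine ⟨LinearEquiv.ofEq _ _ hA ≪≫ₗ φ ≪≫ₗ LinearEquiv.ofEq _ _ hS.symm, fun k hk => ?_⟩
  have h1 := hφ (omegaElement k) (Submodule.subset_span ⟨k, hk, rfl⟩)
  simp only [linExt_zetaA_omegaElement hk.1, linExt_zetaS_omegaElement hk.1] at h1
  refine Subtype.ext ?_
  have h2 := congrArg Subtype.val h1
  exact h2

theorem ker_eq_of_kanekoZagier (h : KanekoZagierConjecture) :
    LinearMap.ker ((linExt zetaA).domRestrict H1) =
      LinearMap.ker ((linExt zetaS).domRestrict H1) := by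
  obtain ⟨φ, hφ⟩ := h
  let F : WordAlg →ₗ[ℚ] algZA := linExt fun k => ⟨zetaA k, zetaA_mem k⟩
  ext ⟨a, ha⟩
  have hA : linExt zetaA a = F a :=
    eqOn_H1 (f := linExt zetaA) (g := algZA.val.toLinearMap ∘ₗ F)
      (fun k => by rw [LinearMap.comp_apply, linExt_yIndex, linExt_yIndex]; rfl) ha
  have hS : linExt zetaS a = φ (F a) :=
    eqOn_H1 (f := linExt zetaS) (g := φ.toLinearMap ∘ₗ F)
      (fun k => by rw [LinearMap.comp_apply, linExt_yIndex, linExt_yIndex]; exact (hφ k).symm) ha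
  rw [LinearMap.mem_ker, LinearMap.mem_ker, LinearMap.domRestrict_apply,
    LinearMap.domRestrict_apply]
  change linExt zetaA a = 0 ↔ linExt zetaS a = 0
  rw [hA, hS, EmbeddingLike.map_eq_zero_iff, ZeroMemClass.coe_eq_zero]

end OmegaValue

end

theorem mainTheorem1 :
    (∀ (k : OmegaValue.Index) (hk : k ≠ []), 2 ≤ k.length →
      OmegaValue.omegaA k =
        (-1) ^ (k.getLast hk : ℕ) *
          OmegaValue.linExt OmegaValue.zetaA (OmegaValue.omegaWord k hk)) ∧
    (∀ (k : OmegaValue.Index) (hk : k ≠ []), 2 ≤ k.length →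
      Filter.Tendsto (OmegaValue.omegaRoot k) Filter.atTop (nhds (OmegaValue.Omega k)) ∧
      (∃ z : OmegaValue.algZ, ((z : ℝ) : ℂ) = OmegaValue.Omega k) ∧
      OmegaValue.omegaS k =
        (-1) ^ (k.getLast hk : ℕ) *
          OmegaValue.linExt OmegaValue.zetaS (OmegaValue.omegaWord k hk)) ∧
    (LinearMap.ker ((OmegaValue.linExt OmegaValue.zetaA).domRestrict OmegaValue.H1) =
        LinearMap.ker ((OmegaValue.linExt OmegaValue.zetaS).domRestrict OmegaValue.H1) →
      OmegaValue.OmegaConjecture) ∧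
    (OmegaValue.KanekoZagierConjecture → OmegaValue.OmegaConjecture) := by
  refine ⟨OmegaValue.omegaA_eq, fun k hk h2 => ⟨?_, ⟨_, (OmegaValue.Omega_eq k h2).symm⟩,
    OmegaValue.omegaS_eq k hk h2⟩, OmegaValue.omegaConjecture_of_ker_eq, fun h =>
    OmegaValue.omegaConjecture_of_ker_eq (OmegaValue.ker_eq_of_kanekoZagier h)⟩
  rw [OmegaValue.Omega_eq k h2]
  exact OmegaValue.tendsto_omegaRoot k h2
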